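/- **Conventions.** Let $\Omega\subseteq\mathbb R^d$ be open, let $p,q\in[1,\infty]$, and write $\omega\Subset\Omega$ if $\omega$ is open with compact closure contained in $\Omega$. Put $\|g\|_{W^{k,p}(\omega)}=\max_{|\alpha|\le k}\|\partial^\alpha g\|_{L^p(\omega)}$. If $q=\infty$, a condition $\int_0^1 g(\varepsilon)^q\,\frac{d\varepsilon}{\varepsilon}<\infty$ is to be read as $\sup_{0<\varepsilon<1}g(\varepsilon)<\infty$. Let $\mathcal E_q(\Omega)$ (respectively $\mathcal N_q(\Omega)$) be the space of nets $(f_\varepsilon)_{\varepsilon\in(0,1)}$ with $\varepsilon\mapsto f_\varepsilon$ in $C((0,1);C^\infty(\Omega))$ such that for all $k\in\mathbb N_0$ and $\omega\Subset\Omega$ the condition $\int_0^1\varepsilon^{qs}\|f_\varepsilon\|^q_{W^{k,p}(\omega)}\frac{d\varepsilon}{\varepsilon}<\infty$ holds for some (respectively every) $s\in\mathbb R$; these spaces do not depend on $p$. Put $\mathcal G_q(\Omega)=\mathcal E_q(\Omega)/\mathcal N_q(\Omega)$. For $k\in\mathbb N_0$, $s\in\mathbb R$ and $r\in[1,\infty]$,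 let $\mathcal G^{k,-s}_{q,L^r_{loc}}(\Omega)$ be the set of all $f\in\mathcal G_q(\Omega)$ that have a representative $(f_\varepsilon)_\varepsilon\in\mathcal E_q(\Omega)$ with $\int_0^1\varepsilon^{qs}\|f_\varepsilon\|^q_{W^{k,r}(\omega)}\frac{d\varepsilon}{\varepsilon}<\infty$ for all $\omega\Subset\Omega$. Let $\mathcal G^\infty_q(\Omega)$ be the set of all $f\in\mathcal G_q(\Omega)$ such that for every $\omega\Subset\Omega$ there is $s\in\mathbb R$ with $f|_\omega\in\mathcal G^{k,-s}_{q,L^p_{loc}}(\omega)$ for all $k\in\mathbb N_0$. A generalized function $f\in\mathcal G_q(\Omega)$ is *strongly $q$-associated* to $T\in\mathcal D'(\Omega)$ if it has a representative $(f_\varepsilon)_\varepsilon$ such that for every $\omega\Subset\Omega$ there is $b>0$ with $$\int_0^1\varepsilon^{-bq}\,|\langle T-f_\varepsilon,\rho\rangle|^q\,\frac{d\varepsilon}{\varepsilon}<\infty\qquad\text{for all }\rho\in\mathcal D(\omega).$$ For $r\in\mathbb R$, a pair $(\varphi,\psi)$ of Schwartz functions on $\mathbb R^d$ is an *LP-pair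 of order $r$* if there are $\sigma>0$ and $\eta\in(0,1)$ with $\hat\varphi(\xi)\ne0$ for $|\xi|\le\sigma$ and $\hat\psi(\xi)\neq0$ for $\eta\sigma\le|\xi|\le\sigma$, and $\int t^\alpha\psi(t)\,dt=0$ for $|\alpha|\le\lfloor r\rfloor$. The Hölder–Zygmund space $C^r_*(\mathbb R^d)=B^r_{\infty,\infty}(\mathbb R^d)$ consists of all $S\in\mathcal S'(\mathbb R^d)$ with $\|S*\varphi\|_{L^\infty}+\sup_{0<y<1}y^{-r}\|S*\psi_y\|_{L^\infty}<\infty$, where $\psi_y=y^{-d}\psi(\cdot/y)$, for every LP-pair $(\varphi,\psi)$ of order $r$ (equivalently, for one such pair). Let $C^r_{*,loc}(\Omega)=\{T\in\mathcal D'(\Omega):\chi T\in C^r_*(\mathbb R^d)\text{ for all }\chi\in\mathcal D(\Omega)\}$. **Theorem.** Let $T\in\mathcal D'(\Omega)$, and let $f\in\mathcal G_q(\Omega)$ be strongly $q$-associated to $T$. (i) If $f\in\mathcal G^\infty_q(\Omega)$, then $T\in C^\infty(\Omega)$. (ii) Let $k\in\mathbb N_0$. If $f\in\mathcal G^{k,-s}_{q,L^\infty_{loc}}(\Omega)$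 for every $s>0$, then $T\in C^{k-s}_{*,loc}(\Omega)$ for every $s>0$. -/

import Mathlib

open MeasureTheory Set TopologicalSpace
open scoped ENNReal NNReal Distributions SchwartzMap FourierTransform

noncomputable section

namespace QGen

/-- Euclidean space `ℝ^d`. -/
abbrev E (d : ℕ) := EuclideanSpace ℝ (Fin d)

/-- `ω ⋐ Ω`: the open set `ω` has compact closure contained in `Ω`. -/
def CompactlyIn {d : ℕ} (ω Ω : Opens (E d)) : Prop :=
  IsCompact (closure (ω : Set (E d))) ∧ closure (ω : Set (E d)) ⊆ Ω

theorem CompactlyIn.le {d : ℕ} {ω Ω : Opens (E d)} (h : CompactlyIn ω Ω) : ω ≤ Ω :=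
  fun _ hx => h.2 (subset_closure hx)

theorem CompactlyIn.trans_le {d : ℕ} {ω Ω Ω' : Opens (E d)} (h : CompactlyIn ω Ω) (h' : Ω ≤ Ω') :
    CompactlyIn ω Ω' :=
  ⟨h.1, fun _ hx => h' (h.2 hx)⟩

/-! ### Norms in the space variable and in the parameter -/

/-- The iterated partial derivative `∂_{i 0} ⋯ ∂_{i (m-1)} g (x)` of order `m`. -/
def pderiv {d : ℕ} (m : ℕ) (i : Fin m → Fin d) (g : E d → ℂ) (x : E d) : ℂ :=
  iteratedFDeriv ℝ m g x (fun j => EuclideanSpace.single (i j) 1)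

/-- The Sobolev norm `max {‖∂^α g‖_{L^p(ω)} : |α| ≤ k}` of a function that is smooth near `ω`.
The words `i : Fin m → Fin d` enumerate (with repetitions) the multi-indices of length `m`. -/
def sobolevNorm {d : ℕ} (k : ℕ) (p : ℝ≥0∞) (ω : Opens (E d)) (g : E d → ℂ) : ℝ≥0∞ :=
  ⨆ (m : ℕ) (_ : m ≤ k) (i : Fin m → Fin d),
    eLpNorm (pderiv m i g) p (volume.restrict (ω : Set (E d)))

/-- The measure `dε/ε` on the interval `(0,1)`. -/
def dlog : Measure ℝ :=
  (volume.restrict (Ioo (0 : ℝ) 1)).withDensity (fun ε => ENNReal.ofReal ε⁻¹)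

/-- `∫_0^1 g(ε)^q dε/ε < ∞`, to be read as `sup_{0<ε<1} g(ε) < ∞` when `q = ∞`. -/
def LqFinite (q : ℝ≥0∞) (g : ℝ → ℝ≥0∞) : Prop :=
  if q = ∞ then ∃ C : ℝ≥0, ∀ ε ∈ Ioo (0 : ℝ) 1, g ε ≤ C
  else ∫⁻ ε, g ε ^ q.toReal ∂dlog < ∞

/-! ### Nets of smooth functions

A net is a total function `f : ℝ → E d → ℂ`; only its values `f ε x` with `ε ∈ (0,1)` and `x ∈ Ω`
are ever used: nets that agree there differ by a negligible net. -/

/-- A net `(f_ε)` of smooth functions on `Ω` that depends continuously on `ε`, that is,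
`ε ↦ f_ε` belongs to `C((0,1); C^∞(Ω))`. -/
def SmoothNet {d : ℕ} (Ω : Opens (E d)) (f : ℝ → E d → ℂ) : Prop :=
  (∀ ε ∈ Ioo (0 : ℝ) 1, ContDiffOn ℝ (⊤ : ℕ∞) (f ε) Ω) ∧
  ∀ m : ℕ, ContinuousOn (fun z : ℝ × E d => iteratedFDeriv ℝ m (f z.1) z.2)
    (Ioo (0 : ℝ) 1 ×ˢ (Ω : Set (E d)))

/-- `∫_0^1 ε^{qs} ‖f_ε‖_{W^{k,p}(ω)}^q dε/ε < ∞` (a supremum when `q = ∞`). -/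
def Growth {d : ℕ} (p q : ℝ≥0∞) (k : ℕ) (s : ℝ) (ω : Opens (E d)) (f : ℝ → E d → ℂ) : Prop :=
  LqFinite q (fun ε => ENNReal.ofReal (ε ^ s) * sobolevNorm k p ω (f ε))

/-- `L^q`-moderate nets. -/
def IsModerate {d : ℕ} (p q : ℝ≥0∞) (Ω : Opens (E d)) (f : ℝ → E d → ℂ) : Prop :=
  SmoothNet Ω f ∧ ∀ (k : ℕ) (ω : Opens (E d)), CompactlyIn ω Ω → ∃ s : ℝ, Growth p q k s ω f

/-- `L^q`-negligible nets. -/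
def IsNegligible {d : ℕ} (p q : ℝ≥0∞) (Ω : Opens (E d)) (f : ℝ → E d → ℂ) : Prop :=
  SmoothNet Ω f ∧ ∀ (k : ℕ) (ω : Opens (E d)), CompactlyIn ω Ω → ∀ s : ℝ, Growth p q k s ω f

/-! ### Helper facts: nets form vector spaces -/

theorem sobolevNorm_add_le {d : ℕ} {k : ℕ} {p : ℝ≥0∞} [Fact (1 ≤ p)] {ω : Opens (E d)}
    {g h : E d → ℂ} (hg : ContDiffOn ℝ (⊤ : ℕ∞) g ω) (hh : ContDiffOn ℝ (⊤ : ℕ∞) h ω) :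
    sobolevNorm k p ω (g + h) ≤ sobolevNorm k p ω g + sobolevNorm k p ω h := by
  refine iSup_le fun m => iSup_le fun hm => iSup_le fun i => ?_
  have key : ∀ u : E d → ℂ, ContDiffOn ℝ (⊤ : ℕ∞) u ω →
      ContinuousOn (pderiv m i u) ω := by
    intro u hu x hx
    have h1 : ContDiffAt ℝ (⊤ : ℕ∞) u x := hu.contDiffAt (ω.isOpen.mem_nhds hx)
    have h2 : ContinuousAt (iteratedFDeriv ℝ m u) x :=
      h1.continuousAt_iteratedFDeriv (by exact_mod_cast le_top)
    exact ((ContinuousMultilinearMap.apply ℝ (fun _ : Fin m => E d) ℂ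
      (fun j => EuclideanSpace.single (i j) 1)).continuous.continuousAt.comp
        h2).continuousWithinAt
  have hae : pderiv m i (g + h) =ᵐ[volume.restrict (ω : Set (E d))]
      pderiv m i g + pderiv m i h := by
    filter_upwards [self_mem_ae_restrict ω.isOpen.measurableSet] with x hx
    have h1 : ContDiffAt ℝ m g x :=
      (hg.contDiffAt (ω.isOpen.mem_nhds hx)).of_le (by exact_mod_cast le_top)
    have h2 : ContDiffAt ℝ m h x :=
      (hh.contDiffAt (ω.isOpen.mem_nhds hx)).of_le (by exact_mod_cast le_top)
    simp [pderiv, iteratedFDeriv_add_apply h1 h2]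
  rw [eLpNorm_congr_ae hae]
  refine (eLpNorm_add_le ((key g hg).aestronglyMeasurable ω.isOpen.measurableSet)
    ((key h hh).aestronglyMeasurable ω.isOpen.measurableSet) (Fact.out)).trans ?_
  exact add_le_add
    (le_iSup_of_le m (le_iSup_of_le hm (le_iSup_of_le i le_rfl)))
    (le_iSup_of_le m (le_iSup_of_le hm (le_iSup_of_le i le_rfl)))

theorem sobolevNorm_smul_le {d : ℕ} {k : ℕ} {p : ℝ≥0∞} {ω : Opens (E d)} (c : ℂ)
    {g : E d → ℂ} (hg : ContDiffOn ℝ (⊤ : ℕ∞) g ω) :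
    sobolevNorm k p ω (c • g) ≤ ‖c‖ₑ * sobolevNorm k p ω g := by
  refine iSup_le fun m => iSup_le fun hm => iSup_le fun i => ?_
  have hae : pderiv m i (c • g) =ᵐ[volume.restrict (ω : Set (E d))] c • pderiv m i g := by
    filter_upwards [self_mem_ae_restrict ω.isOpen.measurableSet] with x hx
    have h1 : ContDiffAt ℝ m g x :=
      (hg.contDiffAt (ω.isOpen.mem_nhds hx)).of_le (by exact_mod_cast le_top)
    simp [pderiv, iteratedFDeriv_const_smul_apply h1]
  rw [eLpNorm_congr_ae hae, eLpNorm_const_smul]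
  gcongr
  exact le_iSup_of_le m (le_iSup_of_le hm (le_iSup_of_le i le_rfl))

theorem measurable_essSup {α : Type*} [MeasurableSpace α] {μ : Measure α} [SFinite μ]
    {F : ℝ × α → ℝ≥0∞} (hF : Measurable F) :
    Measurable (fun ε => essSup (fun x => F (ε, x)) μ) := by
  refine measurable_of_Iic fun a => ?_
  have : (fun ε => essSup (fun x => F (ε, x)) μ) ⁻¹' Iic a =
      {ε | μ (Prod.mk ε ⁻¹' (F ⁻¹' Ioi a)) = 0} := by
    ext ε
    simp only [mem_preimage, mem_Iic, mem_ofPred_eq]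
    constructor
    · intro h
      have h2 : ∀ᵐ x ∂μ, F (ε, x) ≤ a :=
        (ENNReal.ae_le_essSup (fun x => F (ε, x))).mono fun x hx => hx.trans h
      rw [ae_iff] at h2
      simpa [preimage, not_le] using h2
    · intro h
      refine essSup_le_of_ae_le a ?_
      rw [Filter.EventuallyLE, ae_iff]
      simpa [preimage, not_le] using h
  rw [this]
  exact (measurable_measure_prodMk_left (hF measurableSet_Ioi)) (measurableSet_singleton 0)

theorem measurable_eLpNorm {α : Type*} [MeasurableSpace α] {μ : Measure α} [SFinite μ]
    (p : ℝ≥0∞) {F : ℝ × α → ℂ} (hF : Measurable F) :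
    Measurable (fun ε => eLpNorm (fun x => F (ε, x)) p μ) := by
  by_cases h0 : p = 0
  · simp [h0]
  by_cases ht : p = ∞
  · simp only [ht, eLpNorm_exponent_top, eLpNormEssSup]
    exact measurable_essSup (F := fun z => ‖F z‖ₑ) hF.enorm
  · simp only [eLpNorm_eq_lintegral_rpow_enorm_toReal h0 ht]
    exact (Measurable.lintegral_prod_right' (f := fun z => ‖F z‖ₑ ^ p.toReal)
      (hF.enorm.pow_const _)).pow_const _

theorem aemeasurable_dlog {g : ℝ → ℝ≥0∞} {G : ℝ → ℝ≥0∞} (hG : Measurable G)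
    (h : ∀ ε ∈ Ioo (0 : ℝ) 1, g ε = G ε) : AEMeasurable g dlog := by
  refine ⟨G, hG, ?_⟩
  have : ∀ᵐ ε ∂(volume.restrict (Ioo (0 : ℝ) 1)), g ε = G ε := by
    filter_upwards [self_mem_ae_restrict measurableSet_Ioo] with ε hε using h ε hε
  exact (withDensity_absolutelyContinuous _ _).ae_le this

theorem ae_dlog {P : ℝ → Prop} (h : ∀ ε ∈ Ioo (0 : ℝ) 1, P ε) : ∀ᵐ ε ∂dlog, P ε := by
  have : ∀ᵐ ε ∂(volume.restrict (Ioo (0 : ℝ) 1)), P ε := by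
    filter_upwards [self_mem_ae_restrict measurableSet_Ioo] with ε hε using h ε hε
  exact (withDensity_absolutelyContinuous _ _).ae_le this

theorem SmoothNet.aemeasurable_sobolevNorm {d : ℕ} {Ω ω : Opens (E d)} {f : ℝ → E d → ℂ}
    (hf : SmoothNet Ω f) (hω : ω ≤ Ω) (k : ℕ) (p : ℝ≥0∞) :
    AEMeasurable (fun ε => sobolevNorm k p ω (f ε)) dlog := by
  refine AEMeasurable.iSup fun m => AEMeasurable.iSup fun _ => AEMeasurable.iSup fun i => ?_
  set S : Set (ℝ × E d) := Ioo (0 : ℝ) 1 ×ˢ (ω : Set (E d))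
  have hS : MeasurableSet S := measurableSet_Ioo.prod ω.isOpen.measurableSet
  have hc : ContinuousOn (fun z : ℝ × E d => pderiv m i (f z.1) z.2) S :=
    (ContinuousMultilinearMap.apply ℝ (fun _ : Fin m => E d) ℂ
      (fun j => EuclideanSpace.single (i j) 1)).continuous.comp_continuousOn
        ((hf.2 m).mono (prod_mono le_rfl hω))
  have hF : Measurable (S.indicator fun z : ℝ × E d => pderiv m i (f z.1) z.2) := by
    classical
    have := (measurable_zero (α := ℂ) (β := ℝ × E d))
    rw [← Set.piecewise_eq_indicator]
    exact ContinuousOn.measurable_piecewise hc continuousOn_const hS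
  refine aemeasurable_dlog (measurable_eLpNorm (μ := volume.restrict (ω : Set (E d))) p hF) ?_
  intro ε hε
  refine eLpNorm_congr_ae ?_
  filter_upwards [self_mem_ae_restrict ω.isOpen.measurableSet] with x hx
  rw [indicator_of_mem (show (ε, x) ∈ S from ⟨hε, hx⟩)]

theorem LqFinite.mono {q : ℝ≥0∞} {g h : ℝ → ℝ≥0∞} (hh : LqFinite q h)
    (hgh : ∀ ε ∈ Ioo (0 : ℝ) 1, g ε ≤ h ε) : LqFinite q g := by
  unfold LqFinite at *
  split_ifs at * with hq
  · obtain ⟨C, hC⟩ := hh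
    exact ⟨C, fun ε hε => (hgh ε hε).trans (hC ε hε)⟩
  · refine lt_of_le_of_lt (lintegral_mono_ae (ae_dlog fun ε hε => ?_)) hh
    exact ENNReal.rpow_le_rpow (hgh ε hε) ENNReal.toReal_nonneg

theorem LqFinite.add {q : ℝ≥0∞} [hq1 : Fact (1 ≤ q)] {g h : ℝ → ℝ≥0∞} (hg : LqFinite q g)
    (hh : LqFinite q h) (hm : AEMeasurable g dlog) : LqFinite q (fun ε => g ε + h ε) := by
  unfold LqFinite at *
  split_ifs at * with hq
  · obtain ⟨C, hC⟩ := hg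
    obtain ⟨D, hD⟩ := hh
    exact ⟨C + D, fun ε hε => by push_cast; exact add_le_add (hC ε hε) (hD ε hε)⟩
  · exact ENNReal.lintegral_rpow_add_lt_top_of_lintegral_rpow_lt_top hm hg hh
      (by simpa using ENNReal.toReal_mono hq hq1.out)

theorem LqFinite.const_mul {q : ℝ≥0∞} {g : ℝ → ℝ≥0∞} (hg : LqFinite q g) {c : ℝ≥0∞}
    (hc : c ≠ ∞) : LqFinite q (fun ε => c * g ε) := by
  unfold LqFinite at *
  split_ifs at * with hq
  · obtain ⟨C, hC⟩ := hg
    lift c to ℝ≥0 using hc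
    exact ⟨c * C, fun ε hε => by push_cast; gcongr; exact hC ε hε⟩
  · simp_rw [ENNReal.mul_rpow_of_nonneg _ _ (ENNReal.toReal_nonneg (a := q))]
    rw [lintegral_const_mul' _ _ (ENNReal.rpow_ne_top_of_nonneg ENNReal.toReal_nonneg hc)]
    exact ENNReal.mul_lt_top (ENNReal.rpow_lt_top_of_nonneg ENNReal.toReal_nonneg hc) hg

theorem lqFinite_zero {q : ℝ≥0∞} [hq1 : Fact (1 ≤ q)] : LqFinite q (fun _ => 0) := by
  unfold LqFinite
  split_ifs with hq
  · exact ⟨0, by simp⟩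
  · have : 0 < q.toReal := ENNReal.toReal_pos (zero_lt_one.trans_le hq1.out).ne' hq
    simp [ENNReal.zero_rpow_of_pos this]

theorem Growth.mono_exp {d : ℕ} {p q : ℝ≥0∞} {k : ℕ} {s t : ℝ} {ω : Opens (E d)}
    {f : ℝ → E d → ℂ} (h : Growth p q k s ω f) (hst : s ≤ t) : Growth p q k t ω f := by
  refine LqFinite.mono h fun ε hε => ?_
  gcongr ENNReal.ofReal ?_ * _
  exact Real.rpow_le_rpow_of_exponent_ge hε.1 hε.2.le hst

theorem SmoothNet.mono {d : ℕ} {Ω ω : Opens (E d)} {f : ℝ → E d → ℂ} (hf : SmoothNet Ω f)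
    (h : ω ≤ Ω) : SmoothNet ω f :=
  ⟨fun ε hε => (hf.1 ε hε).mono h, fun m => (hf.2 m).mono (prod_mono le_rfl h)⟩

theorem smoothNet_zero {d : ℕ} (Ω : Opens (E d)) : SmoothNet Ω 0 := by
  refine ⟨fun ε _ => contDiffOn_const (c := (0 : ℂ)), fun m => ?_⟩
  have : (fun z : ℝ × E d => iteratedFDeriv ℝ m ((0 : ℝ → E d → ℂ) z.1) z.2) = fun _ => 0 := by
    funext z
    simp
  rw [this]
  exact continuousOn_const

theorem SmoothNet.add {d : ℕ} {Ω : Opens (E d)} {f g : ℝ → E d → ℂ} (hf : SmoothNet Ω f)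
    (hg : SmoothNet Ω g) : SmoothNet Ω (f + g) := by
  refine ⟨fun ε hε => (hf.1 ε hε).add (hg.1 ε hε), fun m => ?_⟩
  refine ((hf.2 m).add (hg.2 m)).congr fun z hz => ?_
  have h1 : ContDiffAt ℝ m (f z.1) z.2 :=
    ((hf.1 _ hz.1).contDiffAt (Ω.isOpen.mem_nhds hz.2)).of_le (by exact_mod_cast le_top)
  have h2 : ContDiffAt ℝ m (g z.1) z.2 :=
    ((hg.1 _ hz.1).contDiffAt (Ω.isOpen.mem_nhds hz.2)).of_le (by exact_mod_cast le_top)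
  exact iteratedFDeriv_add_apply h1 h2

theorem SmoothNet.smul {d : ℕ} {Ω : Opens (E d)} {f : ℝ → E d → ℂ} (c : ℂ)
    (hf : SmoothNet Ω f) : SmoothNet Ω (c • f) := by
  refine ⟨fun ε hε => (hf.1 ε hε).const_smul c, fun m => ?_⟩
  refine ((hf.2 m).const_smul c).congr fun z hz => ?_
  have h1 : ContDiffAt ℝ m (f z.1) z.2 :=
    ((hf.1 _ hz.1).contDiffAt (Ω.isOpen.mem_nhds hz.2)).of_le (by exact_mod_cast le_top)
  exact iteratedFDeriv_const_smul_apply (a := c) h1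

theorem Growth.add {d : ℕ} {p q : ℝ≥0∞} [Fact (1 ≤ p)] [Fact (1 ≤ q)] {k : ℕ} {s : ℝ}
    {Ω ω : Opens (E d)} {f g : ℝ → E d → ℂ} (hf : SmoothNet Ω f) (hg : SmoothNet Ω g)
    (hω : ω ≤ Ω) (h1 : Growth p q k s ω f) (h2 : Growth p q k s ω g) :
    Growth p q k s ω (f + g) := by
  have hm : AEMeasurable (fun ε => ENNReal.ofReal (ε ^ s) * sobolevNorm k p ω (f ε)) dlog :=
    (ENNReal.measurable_ofReal.comp (measurable_id.pow_const s)).aemeasurable.mul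
      (hf.aemeasurable_sobolevNorm hω k p)
  refine (LqFinite.add h1 h2 hm).mono fun ε hε => ?_
  rw [← mul_add]
  gcongr
  exact sobolevNorm_add_le ((hf.1 ε hε).mono hω) ((hg.1 ε hε).mono hω)

theorem Growth.smul {d : ℕ} {p q : ℝ≥0∞} {k : ℕ} {s : ℝ} {Ω ω : Opens (E d)}
    {f : ℝ → E d → ℂ} (c : ℂ) (hf : SmoothNet Ω f) (hω : ω ≤ Ω) (h1 : Growth p q k s ω f) :
    Growth p q k s ω (c • f) := by
  refine (LqFinite.const_mul h1 (c := ‖c‖ₑ) enorm_ne_top).mono fun ε hε => ?_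
  rw [mul_left_comm]
  gcongr
  exact sobolevNorm_smul_le c ((hf.1 ε hε).mono hω)

theorem growth_zero {d : ℕ} {p q : ℝ≥0∞} [Fact (1 ≤ q)] (k : ℕ) (s : ℝ) (ω : Opens (E d)) :
    Growth p q k s ω 0 := by
  refine lqFinite_zero.mono fun ε _ => ?_
  have h0 : ∀ (m : ℕ) (i : Fin m → Fin d), pderiv m i (0 : E d → ℂ) = 0 := by
    intro m i
    funext x
    simp [pderiv]
  simp [sobolevNorm, h0]

/-! ### The spaces `𝓔_q(Ω)`, `𝓝_q(Ω)` and `𝓖_q(Ω) = 𝓔_q(Ω) / 𝓝_q(Ω)` -/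

/-- The space `𝓔_q(Ω)` of `L^q`-moderate nets. -/
def moderate {d : ℕ} (p q : ℝ≥0∞) [Fact (1 ≤ p)] [Fact (1 ≤ q)] (Ω : Opens (E d)) :
    Submodule ℂ (ℝ → E d → ℂ) where
  carrier := {f | IsModerate p q Ω f}
  zero_mem' := ⟨smoothNet_zero Ω, fun k ω _ => ⟨0, growth_zero k 0 ω⟩⟩
  add_mem' := by
    rintro f g ⟨hf, hf'⟩ ⟨hg, hg'⟩
    refine ⟨hf.add hg, fun k ω hω => ?_⟩
    obtain ⟨s, hs⟩ := hf' k ω hω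
    obtain ⟨t, ht⟩ := hg' k ω hω
    exact ⟨max s t, Growth.add hf hg hω.le (hs.mono_exp (le_max_left s t))
      (ht.mono_exp (le_max_right s t))⟩
  smul_mem' := by
    rintro c f ⟨hf, hf'⟩
    refine ⟨hf.smul c, fun k ω hω => ?_⟩
    obtain ⟨s, hs⟩ := hf' k ω hω
    exact ⟨s, hs.smul c hf hω.le⟩

/-- The space `𝓝_q(Ω)` of `L^q`-negligible nets. -/
def negligible {d : ℕ} (p q : ℝ≥0∞) [Fact (1 ≤ p)] [Fact (1 ≤ q)] (Ω : Opens (E d)) :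
    Submodule ℂ (ℝ → E d → ℂ) where
  carrier := {f | IsNegligible p q Ω f}
  zero_mem' := ⟨smoothNet_zero Ω, fun k ω _ s => growth_zero k s ω⟩
  add_mem' := by
    rintro f g ⟨hf, hf'⟩ ⟨hg, hg'⟩
    exact ⟨hf.add hg, fun k ω hω s => Growth.add hf hg hω.le (hf' k ω hω s) (hg' k ω hω s)⟩
  smul_mem' := by
    rintro c f ⟨hf, hf'⟩
    exact ⟨hf.smul c, fun k ω hω s => (hf' k ω hω s).smul c hf hω.le⟩

/-- The space `𝓖_q(Ω)` of generalized functions (which does not depend on `p`, up to the canonical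
identification). -/
abbrev GenFun {d : ℕ} (p q : ℝ≥0∞) [Fact (1 ≤ p)] [Fact (1 ≤ q)] (Ω : Opens (E d)) : Type :=
  moderate p q Ω ⧸ (negligible p q Ω).submoduleOf (moderate p q Ω)

namespace GenFun

variable {d : ℕ} {p q : ℝ≥0∞} [Fact (1 ≤ p)] [Fact (1 ≤ q)] {Ω : Opens (E d)}

/-- `f = [(u_ε)_ε]`. -/
def IsRep (f : GenFun p q Ω) (u : ℝ → E d → ℂ) : Prop :=
  ∃ hu : u ∈ moderate p q Ω,
    f = ((negligible p q Ω).submoduleOf (moderate p q Ω)).mkQ ⟨u, hu⟩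

theorem moderate_le {ω Ω : Opens (E d)} (h : ω ≤ Ω) : moderate p q Ω ≤ moderate p q ω :=
  fun _ hf => ⟨hf.1.mono h, fun k ω' hω' => hf.2 k ω' (hω'.trans_le h)⟩

theorem negligible_le {ω Ω : Opens (E d)} (h : ω ≤ Ω) : negligible p q Ω ≤ negligible p q ω :=
  fun _ hf => ⟨hf.1.mono h, fun k ω' hω' => hf.2 k ω' (hω'.trans_le h)⟩

/-- The restriction map `f ↦ f|_ω` from `𝓖_q(Ω)` to `𝓖_q(ω)`. -/
def restrict {ω : Opens (E d)} (h : ω ≤ Ω) : GenFun p q Ω →ₗ[ℂ] GenFun p q ω :=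
  Submodule.mapQ _ _ (Submodule.inclusion (moderate_le h)) (fun _ hx => negligible_le h hx)

/-- The space `𝓖^{k,-s}_{q,r}(Ω)`: classes with a representative `(u_ε) ∈ 𝓔_q(Ω)` such that
`∫_0^1 ε^{sq} ‖u_ε‖_{W^{k,r}(ω)}^q dε/ε < ∞` for all `ω ⋐ Ω`. -/
def besovType (r : ℝ≥0∞) (k : ℕ) (s : ℝ) : Set (GenFun p q Ω) :=
  {f | ∃ u, f.IsRep u ∧ ∀ ω : Opens (E d), CompactlyIn ω Ω → Growth r q k s ω u}

/-- The space `𝓖^∞_q(Ω)` of regular generalized functions. -/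
def regular : Set (GenFun p q Ω) :=
  {f | ∀ (ω : Opens (E d)) (h : CompactlyIn ω Ω), ∃ s : ℝ, ∀ k : ℕ,
    restrict h.le f ∈ besovType (p := p) (q := q) (Ω := ω) p k s}

end GenFun

/-! ### Distributions -/

/-- The pairing `⟨T, ρ⟩` of a distribution with a complex test function
(a distribution in Mathlib acts on real test functions). -/
def pair {d : ℕ} {Ω : Opens (E d)} (T : 𝓓'(Ω, ℂ)) (ρ : 𝓓(Ω, ℂ)) : ℂ :=
  T (TestFunction.postcompCLM (𝕜 := ℝ) Complex.reCLM ρ) +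
    Complex.I * T (TestFunction.postcompCLM (𝕜 := ℝ) Complex.imCLM ρ)

/-- `f ∈ 𝓖_q(Ω)` is strongly `q`-associated to `T ∈ 𝓓'(Ω)`: some representative `(u_ε)` satisfies
`(∀ ω ⋐ Ω)(∃ b > 0)(∀ ρ ∈ 𝓓(ω)) ∫_0^1 ε^{-bq} |⟨T - u_ε, ρ⟩|^q dε/ε < ∞`
(a supremum when `q = ∞`). -/
def StronglyAssociated {d : ℕ} {p q : ℝ≥0∞} [Fact (1 ≤ p)] [Fact (1 ≤ q)] {Ω : Opens (E d)}
    (T : 𝓓'(Ω, ℂ)) (f : GenFun p q Ω) : Prop :=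
  ∃ u, f.IsRep u ∧ ∀ ω : Opens (E d), CompactlyIn ω Ω → ∃ b : ℝ, 0 < b ∧
    ∀ ρ : 𝓓(Ω, ℂ), tsupport ρ ⊆ ω →
      LqFinite q (fun ε => ENNReal.ofReal (ε ^ (-b)) * ‖pair T ρ - ∫ x, u ε x * ρ x‖ₑ)

/-- `T ∈ C^∞(Ω)`: the distribution `T` is given by a smooth function on `Ω`. -/
def IsSmooth {d : ℕ} {Ω : Opens (E d)} (T : 𝓓'(Ω, ℂ)) : Prop :=
  ∃ g : E d → ℂ, ContDiffOn ℝ (⊤ : ℕ∞) g Ω ∧ ∀ ρ : 𝓓(Ω, ℂ), pair T ρ = ∫ x, g x * ρ x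

/-- The test function `χ ρ` for `χ ∈ 𝓓(Ω)` and `ρ ∈ 𝓢(ℝ^d)`. -/
def mulTest {d : ℕ} {Ω : Opens (E d)} (χ : 𝓓(Ω, ℂ)) (ρ : 𝓢(E d, ℂ)) : 𝓓(Ω, ℂ) where
  toFun := fun x => χ x * ρ x
  contDiff' := χ.contDiff.mul (ρ.smooth _)
  hasCompactSupport' := χ.hasCompactSupport.mul_right
  tsupport_subset' := (tsupport_mul_subset_left (f := χ) (g := ρ)).trans χ.tsupport_subset

/-! ### Besov spaces -/

/-- The convolution `(S * ψ)(x) = ⟨S, ψ(x - ·)⟩` of a tempered distribution with a Schwartz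
function. -/
def conv {d : ℕ} (S : 𝓢'(E d, ℂ)) (ψ : 𝓢(E d, ℂ)) (x : E d) : ℂ :=
  S ((SchwartzMap.compCLMOfContinuousLinearEquiv ℂ (ContinuousLinearEquiv.neg ℝ) ψ).compSubConstCLM
    ℂ x)

theorem conv_kernel_apply {d : ℕ} (ψ : 𝓢(E d, ℂ)) (x z : E d) :
    (SchwartzMap.compCLMOfContinuousLinearEquiv ℂ (ContinuousLinearEquiv.neg ℝ) ψ).compSubConstCLM
      ℂ x z = ψ (x - z) := by
  simp

/-- The dilation `ψ_y = y^{-d} ψ(· / y)` for `y ≠ 0` (and `0` for `y = 0`). -/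
def dilate {d : ℕ} (ψ : 𝓢(E d, ℂ)) (y : ℝ) : 𝓢(E d, ℂ) :=
  if hy : y = 0 then 0
  else ((y ^ d)⁻¹ : ℝ) • SchwartzMap.compCLMOfContinuousLinearEquiv ℂ
    (ContinuousLinearEquiv.smulLeft (Units.mk0 y⁻¹ (inv_ne_zero hy))) ψ

theorem dilate_apply {d : ℕ} (ψ : 𝓢(E d, ℂ)) {y : ℝ} (hy : y ≠ 0) (x : E d) :
    dilate ψ y x = ((y ^ d)⁻¹ : ℝ) * ψ (y⁻¹ • x) := by
  simp [dilate, hy, Units.smul_def]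

/-- `(φ, ψ)` is a (generalized) Littlewood–Paley pair of order `s`. -/
def IsLPPair {d : ℕ} (s : ℝ) (φ ψ : 𝓢(E d, ℂ)) : Prop :=
  (∃ σ : ℝ, 0 < σ ∧ ∃ η ∈ Ioo (0 : ℝ) 1,
    (∀ ξ : E d, ‖ξ‖ ≤ σ → 𝓕 (φ : E d → ℂ) ξ ≠ 0) ∧
    (∀ ξ : E d, η * σ ≤ ‖ξ‖ → ‖ξ‖ ≤ σ → 𝓕 (ψ : E d → ℂ) ξ ≠ 0)) ∧
  ∀ α : Fin d → ℕ, ((∑ i, α i : ℕ) : ℤ) ≤ ⌊s⌋ → ∫ t : E d, (∏ i, ((t i : ℝ) : ℂ) ^ α i) * ψ t = 0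

/-- The Besov space `B^s_{p,q}(ℝ^d)`: the tempered distributions `S` for which
`‖S * φ‖_{L^p} + (∫_0^1 y^{-qs} ‖S * ψ_y‖_{L^p}^q dy/y)^{1/q}` (a supremum when `q = ∞`) is finite
for every Littlewood–Paley pair `(φ, ψ)` of order `s`; it is a standard fact that the
finiteness for one pair and for all pairs are equivalent. -/
def besov (d : ℕ) (p q : ℝ≥0∞) (s : ℝ) : Set 𝓢'(E d, ℂ) :=
  {S | ∀ φ ψ : 𝓢(E d, ℂ), IsLPPair s φ ψ →
    eLpNorm (conv S φ) p volume < ∞ ∧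
    LqFinite q (fun y => ENNReal.ofReal (y ^ (-s)) * eLpNorm (conv S (dilate ψ y)) p volume)}

/-- The Hölder–Zygmund space `C^r_*(ℝ^d) = B^r_{∞,∞}(ℝ^d)`, `r ∈ ℝ`. -/
def zygmund (d : ℕ) (r : ℝ) : Set 𝓢'(E d, ℂ) := besov d ∞ ∞ r

/-- The local space `X_loc(Ω)`: the distributions `T ∈ 𝓓'(Ω)` such that, for every `χ ∈ 𝓓(Ω)`, the
compactly supported distribution `χ T : ρ ↦ ⟨T, χ ρ⟩` belongs to `X`. -/
def locSpace {d : ℕ} (X : Set 𝓢'(E d, ℂ)) (Ω : Opens (E d)) : Set 𝓓'(Ω, ℂ) :=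
  {T | ∀ χ : 𝓓(Ω, ℂ), ∃ S ∈ X, ∀ ρ : 𝓢(E d, ℂ), S ρ = pair T (mulTest χ ρ)}

end QGen

end

/-!
Throughout, `u` is a representative of `f` witnessing the strong association to `T`, and
`defect T u ε ρ = ⟨T - u_ε, ρ⟩`.

**Uniform association.** For each test function `ρ` supported in a compact set `K`, the averages
of `|⟨T - u_ε, ρ⟩|` over dyadic intervals `δ ≤ ε ≤ 2δ` are `O(δ ^ b)`, as `t ≤ 1 + t ^ q`
(`LqFinite.exists_lintegral_Icc_le`). The space `𝓓_K` is a Fréchet space, hence barrelled, and the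
averages are continuous seminorms on it, so by Banach–Steinhaus (`exists_uniform_defect_bound`)
the bound is uniform: it is at most `C δ ^ b` times the supremum of the derivatives of `ρ` of
order at most some `N`.

**Interpolation.** Any other representative `v`, such as one with the prescribed growth of `f`,
differs from `u` by a negligible net, which is dominated by every power of `δ`. Hence
(`UniformlyAssociated.exists_norm_pair_le`) `⟨T, ρ⟩` is bounded, for every `δ`, by `C M δ ^ b`,
where `M` bounds the derivatives of `ρ` up to order `N`, plus an average of `|⟨v_ε, ρ⟩|` over
`ε ∼ δ`. For test functions `ρ` oscillating or concentrated at scale `y`, the number `M` is a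
negative power of `y`; with `δ ∼ y ^ a` and `a` large the first term is as small as desired. If
the growth exponent `s` of `v` is fixed or small, the loss `δ ^ (-s) ∼ y ^ (-a s)` in the second
term is harmless.

**(ii)** Take `ρ = χ ψ_y(x - ·)`. The vanishing moments of `ψ` and Taylor's formula
(`norm_integral_mul_dilate_le`) give `|⟨v_ε, ρ⟩| ≲ y ^ m ‖v_ε‖_{W^{m,∞}}` with `k - s < m ≤ k`.
This yields `|⟨T, ρ⟩| ≲ y ^ (k - s)` once the growth exponent of `v` is small compared with `a⁻¹`
(`mem_locSpace_zygmund`).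

**(i)** Take `ρ = χ e^{-2πi⟨·,ξ⟩}` and `y = (1 + |ξ|)⁻¹`. Integration by parts gains any power of
`|ξ|⁻¹` at the price of derivatives of `v_ε`, whose growth exponent does not depend on their
order. So the Fourier transform of `χ T` is rapidly decreasing (`exists_localFourier_decay`), and
by Fourier inversion (`pair_mulTest_eq_integral`) `χ T` is a smooth function. Two of these
functions agree where their cutoffs agree, so they glue to a smooth function on `Ω`
(`isSmooth_of_localizations`).
-/

namespace QGen

/-! ### Completeness of the spaces of test functions supported in a compact set -/

section Complete

open Filter BoundedContinuousFunction
open scoped Topology ContDiff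

variable {V F : Type*} [NormedAddCommGroup V] [NormedSpace ℝ V] [NormedAddCommGroup F]
  [NormedSpace ℝ F]

/-- If all derivatives of a sequence of smooth functions converge uniformly, the limits are the
derivatives of the limit of the sequence. -/
theorem hasFTaylorSeriesUpTo_of_tendstoUniformly {f : ℕ → V → F}
    (hf : ∀ n, ContDiff ℝ ∞ (f n)) {g : (i : ℕ) → V → (V [×i]→L[ℝ] F)}
    (hg : ∀ i, TendstoUniformly (fun n => iteratedFDeriv ℝ i (f n)) (g i) atTop) :
    HasFTaylorSeriesUpTo ∞ (fun x => (g 0 x).curry0) (fun x i => g i x) where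
  zero_eq _ := rfl
  fderiv i _ x := by
    have hlin : TendstoUniformly (fun n x => (iteratedFDeriv ℝ (i + 1) (f n) x).curryLeft)
        (fun x => (g (i + 1) x).curryLeft) atTop := by
      exact (continuousMultilinearCurryLeftEquiv ℝ (fun _ : Fin (i + 1) => V)
        F).isometry.uniformContinuous.comp_tendstoUniformly (hg (i + 1))
    refine hasFDerivAt_of_tendstoUniformly hlin (fun n x => ?_)
      (fun x => (hg i).tendsto_at x) x
    have := ((hf n).ftaylorSeries (𝕜 := ℝ)).fderiv i (by exact_mod_cast WithTop.coe_lt_top i) x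
    exact this
  cont i _ := (hg i).continuous (Frequently.of_forall fun n =>
    (hf n).continuous_iteratedFDeriv (by exact_mod_cast le_top))

instance completeSpace_contDiffMapSupportedIn (K : Compacts V) [CompleteSpace F] :
    CompleteSpace 𝓓_{K}(V, F) := by
  set Φ : 𝓓_{K}(V, F) →L[ℝ] Π i, V →ᵇ (V [×i]→L[ℝ] F) :=
    ContinuousLinearMap.pi (ContDiffMapSupportedIn.structureMapCLM ℝ ⊤)
  have hΦ : IsUniformEmbedding Φ := ContDiffMapSupportedIn.isUniformEmbedding_pi_structureMapCLM ℝ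
  rw [completeSpace_iff_isComplete_range hΦ.isUniformInducing]
  refine IsClosed.isComplete (IsSeqClosed.isClosed ?_)
  intro y g hy hyg
  choose f hf using hy
  have hconv : ∀ i, TendstoUniformly (fun n => iteratedFDeriv ℝ i (f n)) (g i) atTop := by
    intro i
    have h1 : Tendsto (fun n => y n i) atTop (𝓝 (g i)) := (tendsto_pi_nhds.1 hyg) i
    rw [BoundedContinuousFunction.tendsto_iff_tendstoUniformly] at h1
    have heq : (fun n => iteratedFDeriv ℝ i (f n)) = fun n => ⇑(y n i) := by
      funext n x
      simp only [← hf n]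
      change _ = ContDiffMapSupportedIn.structureMapCLM ℝ ⊤ i (f n) x
      rw [ContDiffMapSupportedIn.structureMapCLM_top_apply]
    rw [heq]
    exact h1
  have hT := hasFTaylorSeriesUpTo_of_tendstoUniformly (fun n => (f n).contDiff) hconv
  refine ⟨⟨fun x => (g 0 x).curry0, ?_, ?_⟩, ?_⟩
  · exact hT.contDiff
  · intro x hx
    have h0 := (hconv 0).tendsto_at x
    have h1 : ∀ n, iteratedFDeriv ℝ 0 (f n) x = 0 := fun n =>
      (f n).iteratedFDeriv_zero_on_compl hx
    simp only [h1] at h0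
    have := tendsto_nhds_unique h0 tendsto_const_nhds
    simp [this]
  · ext i x : 2
    change ContDiffMapSupportedIn.structureMapCLM ℝ ⊤ i _ x = _
    rw [ContDiffMapSupportedIn.structureMapCLM_top_apply]
    exact (hT.eq_iteratedFDeriv (by exact_mod_cast le_top) x).symm

/-- The space `𝓓_K` is completely metrizable, so that the Banach–Steinhaus theorem applies to it. -/
instance baireSpace_contDiffMapSupportedIn (K : Compacts V) [CompleteSpace F] :
    BaireSpace 𝓓_{K}(V, F) := by
  have hΦ := ContDiffMapSupportedIn.isUniformEmbedding_pi_structureMapCLM (E := V) (F := F)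
    (n := ⊤) (K := K) ℝ
  have : (uniformity 𝓓_{K}(V, F)).IsCountablyGenerated := by
    rw [← hΦ.comap_uniformity]
    infer_instance
  infer_instance

end Complete

/-! ### Averages over dyadic intervals -/

theorem rpow_le_of_mem_Icc {δ ε : ℝ} (b : ℝ) (hδ : 0 < δ) (hε : ε ∈ Icc δ (2 * δ)) :
    ε ^ b ≤ 2 ^ |b| * δ ^ b := by
  have h1 : 1 ≤ ε / δ := (one_le_div hδ).2 hε.1
  have h2 : ε / δ ≤ 2 := (div_le_iff₀ hδ).2 hε.2
  have h3 : ε = (ε / δ) * δ := by field_simp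
  rw [h3, Real.mul_rpow (by positivity) hδ.le]
  gcongr
  calc (ε / δ) ^ b ≤ (ε / δ) ^ |b| := Real.rpow_le_rpow_of_exponent_le h1 (le_abs_self b)
    _ ≤ 2 ^ |b| := Real.rpow_le_rpow (by positivity) h2 (abs_nonneg b)

theorem mem_Ioo_of_mem_Icc {δ ε : ℝ} (hδ : δ ∈ Ioo (0 : ℝ) (1 / 2)) (hε : ε ∈ Icc δ (2 * δ)) :
    ε ∈ Ioo (0 : ℝ) 1 :=
  ⟨hδ.1.trans_le hε.1, by linarith [hε.2, hδ.2]⟩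

/-- Whatever `q ∈ [1, ∞]` is, the condition `LqFinite q` controls averages over the dyadic intervals
`[δ, 2δ]`, because `t ≤ 1 + t ^ q`. -/
theorem LqFinite.exists_lintegral_Icc_le {q : ℝ≥0∞} [hq1 : Fact (1 ≤ q)] {b : ℝ} {h : ℝ → ℝ≥0∞}
    (hh : LqFinite q (fun ε => ENNReal.ofReal (ε ^ (-b)) * h ε)) :
    ∃ C : ℝ, 0 ≤ C ∧ ∀ δ ∈ Ioo (0 : ℝ) (1 / 2),
      ∫⁻ ε in Icc δ (2 * δ), h ε ≤ ENNReal.ofReal (C * δ ^ (b + 1)) := by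
  set G : ℝ → ℝ≥0∞ := fun ε => ENNReal.ofReal (ε ^ (-b)) * h ε with hG
  have hvol : ∀ δ : ℝ, volume (Icc δ (2 * δ)) = ENNReal.ofReal δ := fun δ => by
    rw [Real.volume_Icc]; congr 1; ring
  have step : ∃ C : ℝ, 0 ≤ C ∧ ∀ δ ∈ Ioo (0 : ℝ) (1 / 2),
      ∫⁻ ε in Icc δ (2 * δ), G ε ≤ ENNReal.ofReal (C * δ) := by
    unfold LqFinite at hh
    split_ifs at hh with hq
    · obtain ⟨C, hC⟩ := hh
      refine ⟨C, C.2, fun δ hδ => ?_⟩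
      calc ∫⁻ ε in Icc δ (2 * δ), G ε ≤ ∫⁻ ε in Icc δ (2 * δ), (C : ℝ≥0∞) :=
            setLIntegral_mono' measurableSet_Icc fun ε hε => hC ε (mem_Ioo_of_mem_Icc hδ hε)
        _ = ENNReal.ofReal (C * δ) := by
            rw [setLIntegral_const, hvol, ENNReal.ofReal_mul C.coe_nonneg,
              ENNReal.ofReal_coe_nnreal]
    · have hq' : 1 ≤ q.toReal := by simpa using ENNReal.toReal_mono hq hq1.out
      set A : ℝ≥0∞ := ∫⁻ ε, G ε ^ q.toReal ∂dlog
      have hA : A ≠ ∞ := hh.ne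
      refine ⟨1 + 2 * A.toReal, by positivity, fun δ hδ => ?_⟩
      have hsub : Icc δ (2 * δ) ⊆ Ioo (0 : ℝ) 1 := fun ε hε => mem_Ioo_of_mem_Icc hδ hε
      have hA' : A = ∫⁻ ε in Ioo (0 : ℝ) 1, ENNReal.ofReal ε⁻¹ * G ε ^ q.toReal := by
        change ∫⁻ ε, G ε ^ q.toReal ∂((volume.restrict (Ioo (0 : ℝ) 1)).withDensity
          (fun ε => ENNReal.ofReal ε⁻¹)) = _
        rw [lintegral_withDensity_eq_lintegral_mul_non_measurable _ (by fun_prop)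
          (by filter_upwards with x using ENNReal.ofReal_lt_top)]
        rfl
      have hle : ∀ t : ℝ≥0∞, t ≤ 1 + t ^ q.toReal := fun t => by
        rcases le_total t 1 with ht | ht
        · exact ht.trans le_self_add
        · exact (ENNReal.le_rpow_self_of_one_le ht hq').trans le_add_self
      calc ∫⁻ ε in Icc δ (2 * δ), G ε ≤ ∫⁻ ε in Icc δ (2 * δ), (1 + G ε ^ q.toReal) :=
            lintegral_mono fun ε => hle _
        _ = ENNReal.ofReal δ + ∫⁻ ε in Icc δ (2 * δ), G ε ^ q.toReal := by
            rw [lintegral_add_left measurable_const, setLIntegral_const, hvol, one_mul]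
        _ ≤ ENNReal.ofReal δ + ∫⁻ ε in Icc δ (2 * δ),
              ENNReal.ofReal (2 * δ) * (ENNReal.ofReal ε⁻¹ * G ε ^ q.toReal) := by
            gcongr 1
            refine setLIntegral_mono' measurableSet_Icc fun ε hε => ?_
            have hε0 : 0 < ε := hδ.1.trans_le hε.1
            rw [← mul_assoc, ← ENNReal.ofReal_mul (by linarith [hδ.1])]
            refine le_mul_of_one_le_left zero_le ?_
            rw [ENNReal.one_le_ofReal, ← div_eq_mul_inv, one_le_div hε0]
            exact hε.2
        _ ≤ ENNReal.ofReal δ + ENNReal.ofReal (2 * δ) * A := by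
            rw [lintegral_const_mul' _ _ ENNReal.ofReal_ne_top, hA']
            gcongr
        _ = ENNReal.ofReal ((1 + 2 * A.toReal) * δ) := by
            conv_lhs => rw [← ENNReal.ofReal_toReal hA]
            rw [← ENNReal.ofReal_mul (by linarith [hδ.1]), ← ENNReal.ofReal_add hδ.1.le
              (mul_nonneg (by linarith [hδ.1]) ENNReal.toReal_nonneg)]
            congr 1; ring
  obtain ⟨C, hC0, hC⟩ := step
  refine ⟨2 ^ |b| * C, by positivity, fun δ hδ => ?_⟩
  have hδb : 0 ≤ 2 ^ |b| * δ ^ b := mul_nonneg (by positivity) (Real.rpow_nonneg hδ.1.le b)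
  calc ∫⁻ ε in Icc δ (2 * δ), h ε
      ≤ ∫⁻ ε in Icc δ (2 * δ), ENNReal.ofReal (2 ^ |b| * δ ^ b) * G ε := by
        refine setLIntegral_mono' measurableSet_Icc fun ε hε => ?_
        have hε0 : 0 < ε := hδ.1.trans_le hε.1
        rw [hG, ← mul_assoc, ← ENNReal.ofReal_mul hδb]
        refine le_mul_of_one_le_left zero_le ?_
        rw [ENNReal.one_le_ofReal, Real.rpow_neg hε0.le, ← div_eq_mul_inv,
          one_le_div (Real.rpow_pos_of_pos hε0 b)]
        exact rpow_le_of_mem_Icc b hδ.1 hε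
    _ ≤ ENNReal.ofReal (2 ^ |b| * δ ^ b) * ENNReal.ofReal (C * δ) := by
        rw [lintegral_const_mul' _ _ ENNReal.ofReal_ne_top]
        gcongr
        exact hC δ hδ
    _ = ENNReal.ofReal (2 ^ |b| * C * δ ^ (b + 1)) := by
        rw [← ENNReal.ofReal_mul hδb, Real.rpow_add_one hδ.1.ne']
        congr 1; ring

/-! ### Distributions as functionals on spaces of test functions supported in a compact set -/

section Pair

variable {d : ℕ} {Ω : Opens (E d)}

theorem pair_add (T : 𝓓'(Ω, ℂ)) (ρ σ : 𝓓(Ω, ℂ)) : pair T (ρ + σ) = pair T ρ + pair T σ := by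
  simp only [pair, map_add]
  ring

theorem pair_smul (T : 𝓓'(Ω, ℂ)) (c : ℂ) (ρ : 𝓓(Ω, ℂ)) : pair T (c • ρ) = c * pair T ρ := by
  have h1 : TestFunction.postcompCLM (𝕜 := ℝ) Complex.reCLM (c • ρ) =
      c.re • TestFunction.postcompCLM (𝕜 := ℝ) Complex.reCLM ρ +
        (-c.im) • TestFunction.postcompCLM (𝕜 := ℝ) Complex.imCLM ρ := by
    ext x
    simp [sub_eq_add_neg]
  have h2 : TestFunction.postcompCLM (𝕜 := ℝ) Complex.imCLM (c • ρ) =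
      c.re • TestFunction.postcompCLM (𝕜 := ℝ) Complex.imCLM ρ +
        c.im • TestFunction.postcompCLM (𝕜 := ℝ) Complex.reCLM ρ := by
    ext x
    simp
  rw [pair, h1, h2]
  simp only [pair, map_add, map_smul, Complex.real_smul]
  conv_rhs => rw [← Complex.re_add_im c]
  push_cast
  linear_combination (-(c.im : ℂ) *
    T (TestFunction.postcompCLM (𝕜 := ℝ) Complex.imCLM ρ)) * Complex.I_sq

/-- The restriction of `pair T` to the test functions supported in a compact set. -/
noncomputable def pairCLM (T : 𝓓'(Ω, ℂ)) {K : Compacts (E d)} (hK : (K : Set (E d)) ⊆ Ω) :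
    𝓓_{K}(E d, ℂ) →L[ℝ] ℂ where
  toFun φ := pair T (TestFunction.ofSupportedIn hK φ)
  map_add' φ ψ := by
    have h : TestFunction.ofSupportedIn hK (φ + ψ) =
        TestFunction.ofSupportedIn hK φ + TestFunction.ofSupportedIn hK ψ := by
      ext x
      simp [TestFunction.ofSupportedIn]
    rw [h, pair_add]
  map_smul' c φ := by
    have h : TestFunction.ofSupportedIn hK (c • φ) =
        (c : ℂ) • TestFunction.ofSupportedIn hK φ := by
      ext x
      simp [TestFunction.ofSupportedIn]
    rw [h, pair_smul, RingHom.id_apply, Complex.real_smul]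
  cont := by
    have h := TestFunction.continuous_ofSupportedIn (F := ℂ) (n := ⊤) hK
    have h1 : ∀ A : ℂ →L[ℝ] ℝ, Continuous fun φ : 𝓓_{K}(E d, ℂ) =>
        T (TestFunction.postcompCLM (𝕜 := ℝ) A (TestFunction.ofSupportedIn hK φ)) := fun A =>
      (map_continuous T).comp ((TestFunction.postcompCLM (𝕜 := ℝ) A).continuous.comp h)
    exact (h1 _).add (continuous_const.mul (h1 _))

/-- A test function supported in `K`, as an element of `𝓓_K`. -/
noncomputable def supportedIn (K : Compacts (E d)) (ρ : 𝓓(Ω, ℂ)) (h : tsupport ρ ⊆ K) :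
    𝓓_{K}(E d, ℂ) :=
  ContDiffMapSupportedIn.of_support_subset ρ.contDiff ((subset_tsupport _).trans h)

/-- A continuous seminorm on `𝓓_K` is dominated by finitely many derivatives. -/
theorem exists_seminorm_le {K : Compacts (E d)} (P : Seminorm ℝ 𝓓_{K}(E d, ℂ))
    (hP : Continuous P) : ∃ (N : ℕ) (C : ℝ), 0 ≤ C ∧ ∀ φ : 𝓓_{K}(E d, ℂ), ∀ M : ℝ, 0 ≤ M →
      (∀ i ≤ N, ∀ x, ‖iteratedFDeriv ℝ i φ x‖ ≤ M) → P φ ≤ C * M := by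
  obtain ⟨s, C, -, hC⟩ := Seminorm.bound_of_continuous
    (ContDiffMapSupportedIn.withSeminorms ℝ (E d) ℂ ⊤ K) P hP
  refine ⟨s.sup id, C, C.2, fun φ M hM h => (hC φ).trans ?_⟩
  rw [smul_apply, NNReal.smul_def, smul_eq_mul]
  gcongr
  refine Seminorm.finset_sup_apply_le hM fun i hi => ?_
  rw [ContDiffMapSupportedIn.seminorm_top_le_iff ℝ hM]
  exact fun x _ => h i (Finset.le_sup (f := id) hi) x

theorem exists_norm_pair_le (T : 𝓓'(Ω, ℂ)) {K : Set (E d)} (hK : IsCompact K) (hKΩ : K ⊆ Ω) :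
    ∃ (N : ℕ) (C : ℝ), 0 ≤ C ∧ ∀ ρ : 𝓓(Ω, ℂ), tsupport ρ ⊆ K → ∀ M : ℝ, 0 ≤ M →
      (∀ i ≤ N, ∀ x, ‖iteratedFDeriv ℝ i ρ x‖ ≤ M) → ‖pair T ρ‖ ≤ C * M := by
  have hc : Continuous fun φ => ‖pairCLM T (K := ⟨K, hK⟩) hKΩ φ‖ := by fun_prop
  obtain ⟨N, C, hC, h⟩ := exists_seminorm_le
    ((normSeminorm ℝ ℂ).comp (pairCLM T (K := ⟨K, hK⟩) hKΩ).toLinearMap) hc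
  exact ⟨N, C, hC, fun ρ hρ M hM hi => h (supportedIn ⟨K, hK⟩ ρ hρ) M hM hi⟩

theorem SmoothNet.continuousOn {u : ℝ → E d → ℂ} (hu : SmoothNet Ω u) :
    ContinuousOn (fun z : ℝ × E d => u z.1 z.2) (Ioo (0 : ℝ) 1 ×ˢ (Ω : Set (E d))) :=
  (ContinuousMultilinearMap.apply ℝ (fun _ : Fin 0 => E d) ℂ 0).continuous.comp_continuousOn
    (hu.2 0)

/-- The pairings `∫ u_ε G_y` with a continuous family of functions supported in a fixed compact set
depend continuously on `(ε, y)`. -/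
theorem SmoothNet.continuousOn_integral_mul {Y : Type*} [TopologicalSpace Y]
    {u : ℝ → E d → ℂ} (hu : SmoothNet Ω u) {K : Set (E d)}
    (hK : IsCompact K) (hKΩ : K ⊆ Ω) {G : Y → E d → ℂ} (hG : Continuous G.uncurry)
    (hGK : ∀ y, ∀ x ∉ K, G y x = 0) :
    ContinuousOn (fun z : ℝ × Y => ∫ x, u z.1 x * G z.2 x) (Ioo (0 : ℝ) 1 ×ˢ univ) := by
  refine continuousOn_integral_of_compact_support (k := K)
    (f := fun (z : ℝ × Y) x => u z.1 x * G z.2 x) hK ?_ fun z x _ hx => by simp [hGK z.2 x hx]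
  rintro ⟨⟨ε, y⟩, x⟩ ⟨⟨hε, -⟩, -⟩
  by_cases hx : x ∈ Ω
  · have h1 : ContinuousAt (fun z : ℝ × E d => u z.1 z.2) (ε, x) :=
      hu.continuousOn.continuousAt ((isOpen_Ioo.prod Ω.isOpen).mem_nhds ⟨hε, hx⟩)
    have h2 : ContinuousAt (fun w : (ℝ × Y) × E d => (w.1.1, w.2)) ((ε, y), x) := by fun_prop
    have h3 : ContinuousAt (fun w : (ℝ × Y) × E d => u w.1.1 w.2) ((ε, y), x) :=
      ContinuousAt.comp_of_eq (g := fun z : ℝ × E d => u z.1 z.2) h1 h2 rfl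
    have h4 : Continuous (fun w : (ℝ × Y) × E d => G w.1.2 w.2) :=
      hG.comp (by fun_prop : Continuous fun w : (ℝ × Y) × E d => (w.1.2, w.2))
    exact (h3.mul h4.continuousAt).continuousWithinAt
  · have hx' : x ∈ Kᶜ := fun h => hx (hKΩ h)
    have : ∀ᶠ w : (ℝ × Y) × E d in nhds ((ε, y), x), u w.1.1 w.2 * G w.1.2 w.2 = 0 := by
      have := (hK.isClosed.isOpen_compl.mem_nhds hx')
      filter_upwards [continuous_snd.continuousAt.preimage_mem_nhds this] with w hw
      rw [hGK _ _ hw, mul_zero]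
    exact (ContinuousAt.congr continuousAt_const (this.mono fun w hw => hw.symm)).continuousWithinAt

end Pair

/-! ### Uniform boundedness for strongly associated nets -/

section Defect

variable {d : ℕ} {Ω : Opens (E d)}

/-- The error `⟨T - u_ε, ρ⟩`. -/
noncomputable def defect (T : 𝓓'(Ω, ℂ)) (u : ℝ → E d → ℂ) (ε : ℝ) (ρ : 𝓓(Ω, ℂ)) : ℂ :=
  pair T ρ - ∫ x, u ε x * ρ x

theorem SmoothNet.continuousOn_defect (T : 𝓓'(Ω, ℂ)) {u : ℝ → E d → ℂ} (hu : SmoothNet Ω u)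
    (ρ : 𝓓(Ω, ℂ)) : ContinuousOn (fun ε => defect T u ε ρ) (Ioo (0 : ℝ) 1) := by
  have h := hu.continuousOn_integral_mul (Y := Unit) (G := fun _ => ρ) ρ.hasCompactSupport
    ρ.tsupport_subset (ρ.continuous.comp continuous_snd) fun _ x hx =>
      image_eq_zero_of_notMem_tsupport hx
  refine continuousOn_const.sub ?_
  exact h.comp (f := fun ε : ℝ => (ε, ())) (by fun_prop) fun ε hε => ⟨hε, mem_univ _⟩

/-- `φ ↦ ⟨T - u_ε, φ⟩` as a continuous linear map on `𝓓_K`. It has this meaning only for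
`ε ∈ (0, 1)`, where `u_ε` is integrable on `K` (`defectCLM_apply`). -/
noncomputable def defectCLM (T : 𝓓'(Ω, ℂ)) (u : ℝ → E d → ℂ) {K : Compacts (E d)}
    (hK : (K : Set (E d)) ⊆ Ω) (ε : ℝ) : 𝓓_{K}(E d, ℂ) →L[ℝ] ℂ :=
  pairCLM T hK -
    ContDiffMapSupportedIn.integralAgainstBilinCLM (ContinuousLinearMap.mul ℝ ℂ) volume (u ε)

theorem defectCLM_apply (T : 𝓓'(Ω, ℂ)) {u : ℝ → E d → ℂ} (hu : SmoothNet Ω u) {K : Compacts (E d)}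
    (hK : (K : Set (E d)) ⊆ Ω) {ε : ℝ} (hε : ε ∈ Ioo (0 : ℝ) 1) (φ : 𝓓_{K}(E d, ℂ)) :
    defectCLM T u hK ε φ = defect T u ε (TestFunction.ofSupportedIn hK φ) := by
  have hint : IntegrableOn (u ε) K volume :=
    (((hu.1 ε hε).continuousOn).mono hK).integrableOn_compact K.isCompact
  rw [defectCLM, sub_apply,
    ContDiffMapSupportedIn.integralAgainstBilinCLM_eq_integral hint, defect]
  congr 2
  funext x
  simp [mul_comm, TestFunction.ofSupportedIn]

theorem SmoothNet.exists_bound {u : ℝ → E d → ℂ} (hu : SmoothNet Ω u) {K : Set (E d)}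
    (hK : IsCompact K) (hKΩ : K ⊆ Ω) {δ : ℝ} (hδ : δ ∈ Ioo (0 : ℝ) (1 / 2)) :
    ∃ B : ℝ, 0 ≤ B ∧ ∀ ε ∈ Icc δ (2 * δ), ∀ x ∈ K, ‖u ε x‖ ≤ B := by
  obtain ⟨B, hB⟩ := (isCompact_Icc.prod hK).exists_bound_of_continuousOn
    (hu.continuousOn.mono (prod_mono (fun ε hε => mem_Ioo_of_mem_Icc hδ hε) hKΩ))
  exact ⟨max B 0, le_max_right _ _, fun ε hε x hx => (hB (ε, x) ⟨hε, hx⟩).trans (le_max_left _ _)⟩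

theorem continuousOn_defectCLM (T : 𝓓'(Ω, ℂ)) {u : ℝ → E d → ℂ} (hu : SmoothNet Ω u)
    {K : Compacts (E d)} (hK : (K : Set (E d)) ⊆ Ω) (φ : 𝓓_{K}(E d, ℂ)) {δ : ℝ}
    (hδ : δ ∈ Ioo (0 : ℝ) (1 / 2)) :
    ContinuousOn (fun ε => ‖defectCLM T u hK ε φ‖) (Icc δ (2 * δ)) :=
  (((hu.continuousOn_defect T (TestFunction.ofSupportedIn hK φ)).norm).mono
    fun _ hε => mem_Ioo_of_mem_Icc hδ hε).congr fun ε hε => by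
      rw [defectCLM_apply T hu hK (mem_Ioo_of_mem_Icc hδ hε)]

/-- The seminorm `φ ↦ δ ^ (-(b + 1)) ∫_δ^{2δ} |⟨T - u_ε, φ⟩| dε` on `𝓓_K`. -/
noncomputable def defectSeminorm (T : 𝓓'(Ω, ℂ)) {u : ℝ → E d → ℂ} (hu : SmoothNet Ω u)
    {K : Compacts (E d)} (hK : (K : Set (E d)) ⊆ Ω) (b : ℝ) (δ : Ioo (0 : ℝ) (1 / 2)) :
    Seminorm ℝ 𝓓_{K}(E d, ℂ) :=
  Seminorm.of
    (fun φ => (δ : ℝ) ^ (-(b + 1)) * ∫ ε in Icc (δ : ℝ) (2 * δ), ‖defectCLM T u hK ε φ‖)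
    (fun φ ψ => by
      have hφ := (continuousOn_defectCLM T hu hK φ δ.2).integrableOn_Icc (μ := volume)
      have hψ := (continuousOn_defectCLM T hu hK ψ δ.2).integrableOn_Icc (μ := volume)
      have h := (continuousOn_defectCLM T hu hK (φ + ψ) δ.2).integrableOn_Icc (μ := volume)
      have := δ.2.1.le
      rw [← mul_add, ← integral_add hφ hψ]
      refine mul_le_mul_of_nonneg_left (integral_mono h (hφ.add hψ) fun ε => ?_) (by positivity)
      simp only [map_add]
      exact norm_add_le _ _)
    (fun c φ => by
      simp only [map_smul, norm_smul, integral_const_mul]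
      ring)

theorem continuous_defectSeminorm (T : 𝓓'(Ω, ℂ)) {u : ℝ → E d → ℂ} (hu : SmoothNet Ω u)
    {K : Compacts (E d)} (hK : (K : Set (E d)) ⊆ Ω) (b : ℝ) (δ : Ioo (0 : ℝ) (1 / 2)) :
    Continuous (defectSeminorm T hu hK b δ) := by
  obtain ⟨B, hB0, hB⟩ := hu.exists_bound K.isCompact hK δ.2
  have hδ := δ.2.1.le
  set c : ℝ≥0 := ⟨(δ : ℝ) ^ (-(b + 1)) * δ, by positivity⟩
  set A : ℝ≥0 := ⟨volume.real (K : Set (E d)) * B * ‖ContinuousLinearMap.mul ℝ ℂ‖, by positivity⟩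
  set q : Seminorm ℝ 𝓓_{K}(E d, ℂ) := c • ((normSeminorm ℝ ℂ).comp (pairCLM T hK).toLinearMap +
    A • ContDiffMapSupportedIn.seminorm ℝ (E d) ℂ ⊤ K 0)
  have hN : Continuous (ContDiffMapSupportedIn.seminorm ℝ (E d) ℂ ⊤ K 0) :=
    (ContDiffMapSupportedIn.withSeminorms ℝ (E d) ℂ ⊤ K).continuous_seminorm 0
  have hq : Continuous q := by
    have : Continuous fun φ => (c : ℝ) * (‖pairCLM T hK φ‖ +
        (A : ℝ) * ContDiffMapSupportedIn.seminorm ℝ (E d) ℂ ⊤ K 0 φ) := by fun_prop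
    exact this
  refine Seminorm.continuous_of_le hq fun φ => ?_
  change (δ : ℝ) ^ (-(b + 1)) * ∫ ε in Icc (δ : ℝ) (2 * δ), ‖defectCLM T u hK ε φ‖ ≤
    ((δ : ℝ) ^ (-(b + 1)) * δ) * (‖pairCLM T hK φ‖ +
      (volume.real (K : Set (E d)) * B * ‖ContinuousLinearMap.mul ℝ ℂ‖) *
        ContDiffMapSupportedIn.seminorm ℝ (E d) ℂ ⊤ K 0 φ)
  rw [mul_assoc]
  gcongr
  have hle : ∀ ε ∈ Icc (δ : ℝ) (2 * δ), ‖‖defectCLM T u hK ε φ‖‖ ≤ ‖pairCLM T hK φ‖ +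
      (volume.real (K : Set (E d)) * B * ‖ContinuousLinearMap.mul ℝ ℂ‖) *
        ContDiffMapSupportedIn.seminorm ℝ (E d) ℂ ⊤ K 0 φ := by
    intro ε hε
    rw [norm_norm, defectCLM, sub_apply]
    refine (norm_sub_le _ _).trans ?_
    gcongr
    refine (ContDiffMapSupportedIn.norm_integralAgainstBilinLM_le (𝕜 := ℝ)).trans ?_
    gcongr
    calc ∫ x in (K : Set (E d)), ‖u ε x‖ ≤ ‖∫ x in (K : Set (E d)), ‖u ε x‖‖ := Real.le_norm_self _
      _ ≤ B * volume.real (K : Set (E d)) :=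
        norm_setIntegral_le_of_norm_le_const K.isCompact.measure_lt_top fun x hx => by
          rw [norm_norm]; exact hB ε hε x hx
      _ = _ := mul_comm _ _
  have := norm_setIntegral_le_of_norm_le_const (μ := volume) (s := Icc (δ : ℝ) (2 * δ))
    (by simp) hle
  refine (Real.le_norm_self _).trans (this.trans (le_of_eq ?_))
  rw [Real.volume_real_Icc_of_le (by linarith)]
  ring

/-- **Uniform association.** If the dyadic averages of `|⟨T - u_ε, ρ⟩|` are `O(δ ^ b)` for each test
function `ρ` supported in `K`, then the implied constant is controlled by finitely many derivatives
of `ρ`: this is the Banach–Steinhaus theorem in the Fréchet space `𝓓_K`. -/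
theorem exists_uniform_defect_bound (T : 𝓓'(Ω, ℂ)) {u : ℝ → E d → ℂ} (hu : SmoothNet Ω u)
    {K : Set (E d)} (hK : IsCompact K) (hKΩ : K ⊆ Ω) {b : ℝ}
    (h : ∀ ρ : 𝓓(Ω, ℂ), tsupport ρ ⊆ K → ∃ C : ℝ, 0 ≤ C ∧ ∀ δ ∈ Ioo (0 : ℝ) (1 / 2),
      ∫⁻ ε in Icc δ (2 * δ), ‖defect T u ε ρ‖ₑ ≤ ENNReal.ofReal (C * δ ^ (b + 1))) :
    ∃ (N : ℕ) (C : ℝ), 0 ≤ C ∧ ∀ ρ : 𝓓(Ω, ℂ), tsupport ρ ⊆ K → ∀ M : ℝ, 0 ≤ M →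
      (∀ i ≤ N, ∀ x, ‖iteratedFDeriv ℝ i ρ x‖ ≤ M) → ∀ δ ∈ Ioo (0 : ℝ) (1 / 2),
      ∫⁻ ε in Icc δ (2 * δ), ‖defect T u ε ρ‖ₑ ≤ ENNReal.ofReal (C * M * δ ^ (b + 1)) := by
  set L : Compacts (E d) := ⟨K, hK⟩
  have hL : (L : Set (E d)) ⊆ Ω := hKΩ
  have key : ∀ (φ : 𝓓_{L}(E d, ℂ)) (δ : Ioo (0 : ℝ) (1 / 2)),
      ∫⁻ ε in Icc (δ : ℝ) (2 * δ), ‖defect T u ε (TestFunction.ofSupportedIn hL φ)‖ₑ =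
        ENNReal.ofReal (∫ ε in Icc (δ : ℝ) (2 * δ), ‖defectCLM T u hL ε φ‖) := by
    intro φ δ
    rw [ofReal_integral_eq_lintegral_ofReal
      ((continuousOn_defectCLM T hu hL φ δ.2).integrableOn_Icc (μ := volume))
      (Filter.Eventually.of_forall fun _ => norm_nonneg _)]
    refine setLIntegral_congr_fun measurableSet_Icc fun ε hε => ?_
    simp only [ofReal_norm]
    rw [defectCLM_apply T hu hL (mem_Ioo_of_mem_Icc δ.2 hε)]
  have hbdd : BddAbove (range (defectSeminorm T hu hL b)) := by
    rw [Seminorm.bddAbove_range_iff]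
    intro φ
    obtain ⟨C, hC0, hC⟩ := h (TestFunction.ofSupportedIn hL φ) φ.tsupport_subset
    refine ⟨C, ?_⟩
    rintro _ ⟨δ, rfl⟩
    have h1 := hC δ δ.2
    have hδ := δ.2.1
    rw [key φ δ, ENNReal.ofReal_le_ofReal_iff (mul_nonneg hC0 (Real.rpow_nonneg hδ.le _))] at h1
    change (δ : ℝ) ^ (-(b + 1)) * ∫ ε in Icc (δ : ℝ) (2 * δ), ‖defectCLM T u hL ε φ‖ ≤ C
    rw [Real.rpow_neg hδ.le, inv_mul_le_iff₀ (Real.rpow_pos_of_pos hδ _)]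
    exact h1.trans_eq (mul_comm _ _)
  obtain ⟨N, C, hC0, hC⟩ := exists_seminorm_le (⨆ δ, defectSeminorm T hu hL b δ) (by
    rw [Seminorm.coe_iSup_eq hbdd]
    exact Seminorm.continuous_iSup _ (fun δ => continuous_defectSeminorm T hu hL b δ) hbdd)
  refine ⟨N, C, hC0, fun ρ hρ M hM hi δ hδ => ?_⟩
  have h1 : defectSeminorm T hu hL b ⟨δ, hδ⟩ (supportedIn L ρ hρ) ≤ C * M :=
    (le_ciSup (f := fun δ => defectSeminorm T hu hL b δ (supportedIn L ρ hρ))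
      (Seminorm.bddAbove_range_iff.1 hbdd _) ⟨δ, hδ⟩).trans
      ((Seminorm.iSup_apply hbdd).symm.trans_le (hC (supportedIn L ρ hρ) M hM hi))
  change δ ^ (-(b + 1)) * ∫ ε in Icc δ (2 * δ), ‖defectCLM T u hL ε (supportedIn L ρ hρ)‖ ≤ C * M
    at h1
  rw [Real.rpow_neg hδ.1.le, inv_mul_le_iff₀ (Real.rpow_pos_of_pos hδ.1 _),
    mul_comm (δ ^ (b + 1))] at h1
  refine (key (supportedIn L ρ hρ) ⟨δ, hδ⟩).trans_le (ENNReal.ofReal_le_ofReal h1)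

end Defect

/-! ### Representatives -/

section Representatives

variable {d : ℕ} {p q : ℝ≥0∞} [Fact (1 ≤ p)] [Fact (1 ≤ q)] {Ω : Opens (E d)}

theorem GenFun.IsRep.smoothNet {f : GenFun p q Ω} {u : ℝ → E d → ℂ} (hu : f.IsRep u) :
    SmoothNet Ω u := hu.1.1

theorem GenFun.IsRep.sub_mem {f : GenFun p q Ω} {u v : ℝ → E d → ℂ} (hu : f.IsRep u)
    (hv : f.IsRep v) : IsNegligible p q Ω (u - v) := by
  obtain ⟨hu, rfl⟩ := hu
  obtain ⟨hv, h⟩ := hv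
  rw [Submodule.mkQ_apply, Submodule.mkQ_apply, Submodule.Quotient.eq] at h
  exact h

theorem GenFun.IsRep.restrict {f : GenFun p q Ω} {u : ℝ → E d → ℂ} (hu : f.IsRep u)
    {ω : Opens (E d)} (h : ω ≤ Ω) : (GenFun.restrict h f).IsRep u := by
  obtain ⟨hu, rfl⟩ := hu
  exact ⟨GenFun.moderate_le h hu, rfl⟩

theorem continuousOn_pderiv {ω : Opens (E d)} {g : E d → ℂ} (hg : ContDiffOn ℝ (⊤ : ℕ∞) g ω)
    (m : ℕ) (i : Fin m → Fin d) : ContinuousOn (pderiv m i g) ω := by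
  intro x hx
  have h1 : ContDiffAt ℝ (⊤ : ℕ∞) g x := hg.contDiffAt (ω.isOpen.mem_nhds hx)
  exact ((ContinuousMultilinearMap.apply ℝ (fun _ : Fin m => E d) ℂ
    (fun j => EuclideanSpace.single (i j) 1)).continuous.continuousAt.comp
      (h1.continuousAt_iteratedFDeriv (by exact_mod_cast le_top))).continuousWithinAt

/-- Hölder's inequality on a set of finite volume. -/
theorem sobolevNorm_mono_exponent {k : ℕ} {ω : Opens (E d)} {p : ℝ≥0∞} (hp : 1 ≤ p)
    {g : E d → ℂ} (hg : ContDiffOn ℝ (⊤ : ℕ∞) g ω) :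
    sobolevNorm k 1 ω g ≤
      volume (ω : Set (E d)) ^ (1 / (1 : ℝ≥0∞).toReal - 1 / p.toReal) * sobolevNorm k p ω g := by
  refine iSup_le fun m => iSup_le fun hm => iSup_le fun i => ?_
  refine (eLpNorm_le_eLpNorm_mul_rpow_measure_univ hp
    ((continuousOn_pderiv hg m i).aestronglyMeasurable ω.isOpen.measurableSet)).trans ?_
  rw [Measure.restrict_apply_univ, mul_comm]
  gcongr
  exact le_iSup_of_le m (le_iSup_of_le hm (le_iSup_of_le i le_rfl))

/-- On a relatively compact set, growth conditions for `L^p` imply those for `L^1`. -/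
theorem Growth.one {k : ℕ} {s : ℝ} {ω : Opens (E d)} {p q : ℝ≥0∞} (hp : 1 ≤ p) {u : ℝ → E d → ℂ}
    (h : Growth p q k s ω u) (hu : SmoothNet ω u) (hω : IsCompact (closure (ω : Set (E d)))) :
    Growth 1 q k s ω u := by
  have hvol : volume (ω : Set (E d)) ≠ ∞ :=
    ((measure_mono subset_closure).trans_lt hω.measure_lt_top).ne
  have hexp : 0 ≤ 1 / (1 : ℝ≥0∞).toReal - 1 / p.toReal := by
    rcases eq_or_ne p ∞ with rfl | hp'
    · simp
    · have : 1 ≤ p.toReal := by simpa using ENNReal.toReal_mono hp' hp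
      rw [ENNReal.toReal_one, div_one, sub_nonneg]
      exact (div_le_one (by linarith)).2 this
  refine (LqFinite.const_mul (g := fun ε => ENNReal.ofReal (ε ^ s) * sobolevNorm k p ω (u ε)) h
    (ENNReal.rpow_ne_top_of_nonneg hexp hvol)).mono fun ε hε => ?_
  rw [mul_left_comm]
  gcongr
  exact sobolevNorm_mono_exponent hp (hu.1 ε hε)

/-- The pairings of a negligible net with test functions supported in `K` decay faster than any
power, with a constant depending only on the supremum of the test function. -/
theorem IsNegligible.exists_lintegral_le {w : ℝ → E d → ℂ} (hw : IsNegligible p q Ω w)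
    {ω : Opens (E d)} (hω : CompactlyIn ω Ω) (b : ℝ) :
    ∃ C : ℝ, 0 ≤ C ∧ ∀ ρ : E d → ℂ, Function.support ρ ⊆ ω → ∀ M : ℝ, 0 ≤ M →
      (∀ x, ‖ρ x‖ ≤ M) → ∀ δ ∈ Ioo (0 : ℝ) (1 / 2),
        ∫⁻ ε in Icc δ (2 * δ), ‖∫ x, w ε x * ρ x‖ₑ ≤ ENNReal.ofReal (C * M * δ ^ (b + 1)) := by
  have hg : Growth 1 q 0 (-b) ω w :=
    (hw.2 0 ω hω (-b)).one Fact.out (hw.1.mono hω.le) hω.1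
  obtain ⟨C, hC0, hC⟩ := LqFinite.exists_lintegral_Icc_le hg
  refine ⟨C, hC0, fun ρ hρ M hM hρM δ hδ => ?_⟩
  have hpt : ∀ ε, ‖∫ x, w ε x * ρ x‖ₑ ≤ ENNReal.ofReal M * sobolevNorm 0 1 ω (w ε) := by
    intro ε
    have h1 : eLpNorm (w ε) 1 (volume.restrict (ω : Set (E d))) ≤ sobolevNorm 0 1 ω (w ε) := by
      refine le_iSup_of_le 0 (le_iSup_of_le le_rfl (le_iSup_of_le Fin.elim0 (le_of_eq ?_)))
      congr 1
    calc ‖∫ x, w ε x * ρ x‖ₑ = ‖∫ x in (ω : Set (E d)), w ε x * ρ x‖ₑ := by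
          rw [setIntegral_eq_integral_of_forall_compl_eq_zero]
          intro x hx
          rw [Function.notMem_support.1 fun h => hx (hρ h), mul_zero]
      _ ≤ ∫⁻ x in (ω : Set (E d)), ‖w ε x * ρ x‖ₑ := enorm_integral_le_lintegral_enorm _
      _ ≤ ∫⁻ x in (ω : Set (E d)), ENNReal.ofReal M * ‖w ε x‖ₑ := by
          refine lintegral_mono fun x => ?_
          rw [enorm_mul, mul_comm]
          gcongr
          rw [← ofReal_norm]
          exact ENNReal.ofReal_le_ofReal (hρM x)
      _ = ENNReal.ofReal M * eLpNorm (w ε) 1 (volume.restrict (ω : Set (E d))) := by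
          rw [lintegral_const_mul' _ _ ENNReal.ofReal_ne_top, eLpNorm_one_eq_lintegral_enorm]
      _ ≤ _ := by gcongr
  calc ∫⁻ ε in Icc δ (2 * δ), ‖∫ x, w ε x * ρ x‖ₑ
      ≤ ∫⁻ ε in Icc δ (2 * δ), ENNReal.ofReal M * sobolevNorm 0 1 ω (w ε) :=
        lintegral_mono fun ε => hpt ε
    _ ≤ ENNReal.ofReal M * ENNReal.ofReal (C * δ ^ (b + 1)) := by
        rw [lintegral_const_mul' _ _ ENNReal.ofReal_ne_top]
        gcongr
        exact hC δ hδ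
    _ = ENNReal.ofReal (C * M * δ ^ (b + 1)) := by
        rw [← ENNReal.ofReal_mul hM]; congr 1; ring

end Representatives

/-! ### Derivatives of products with a cutoff function -/

section Cutoff

variable {d : ℕ}

/-- Expansion of a multilinear form along the standard basis. -/
theorem multilinear_apply_eq_sum {m : ℕ} (A : (E d) [×m]→L[ℝ] ℂ) (v : Fin m → E d) :
    A v = ∑ w : Fin m → Fin d, (∏ l, v l (w l)) • A (fun l => EuclideanSpace.single (w l) 1) := by
  have hv : v = fun l => ∑ k : Fin d, v l k • EuclideanSpace.single k (1 : ℝ) := by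
    funext l
    ext j
    simp [Pi.single_apply]
  conv_lhs => rw [hv]
  rw [ContinuousMultilinearMap.map_sum]
  exact Finset.sum_congr rfl fun w _ => A.map_smul_univ (fun l => v l (w l)) _

theorem norm_iteratedFDeriv_le_sum_pderiv {m : ℕ} (g : E d → ℂ) (x : E d) :
    ‖iteratedFDeriv ℝ m g x‖ ≤ ∑ w : Fin m → Fin d, ‖pderiv m w g x‖ := by
  refine ContinuousMultilinearMap.opNorm_le_bound (by positivity) fun v => ?_
  rw [multilinear_apply_eq_sum, Finset.sum_mul]
  refine norm_sum_le_of_le _ fun w _ => ?_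
  rw [norm_smul, norm_prod, mul_comm]
  gcongr with l
  · rfl
  · exact PiLp.norm_apply_le (v l) (w l)

theorem exists_iteratedFDeriv_bound {χ : E d → ℂ} (hχ : ContDiff ℝ (⊤ : ℕ∞) χ)
    (hc : HasCompactSupport χ) (N : ℕ) :
    ∃ B : ℝ, 0 ≤ B ∧ ∀ i ≤ N, ∀ x, ‖iteratedFDeriv ℝ i χ x‖ ≤ B := by
  have : ∀ i, ∃ B : ℝ, ∀ x, ‖iteratedFDeriv ℝ i χ x‖ ≤ B := fun i =>
    (hχ.continuous_iteratedFDeriv (by exact_mod_cast le_top)).bounded_above_of_compact_support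
      (hc.iteratedFDeriv i)
  choose B hB using this
  have hB0 : ∀ i, 0 ≤ B i := fun i => (norm_nonneg _).trans (hB i 0)
  refine ⟨∑ i ∈ Finset.range (N + 1), B i, Finset.sum_nonneg fun i _ => hB0 i, fun i hi x => ?_⟩
  exact (hB i x).trans (Finset.single_le_sum (fun i _ => hB0 i)
    (Finset.mem_range.2 (Nat.lt_succ_of_le hi)))

/-- Leibniz' rule for the product with a fixed cutoff function. -/
theorem exists_leibniz_bound {χ : E d → ℂ} (hχ : ContDiff ℝ (⊤ : ℕ∞) χ)
    (hc : HasCompactSupport χ) (N : ℕ) :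
    ∃ C : ℝ, 0 ≤ C ∧ ∀ (Ω : Opens (E d)) (g : E d → ℂ), ContDiffOn ℝ (⊤ : ℕ∞) g Ω → ∀ x ∈ Ω,
      ∀ m ≤ N, ‖iteratedFDeriv ℝ m (fun y => χ y * g y) x‖ ≤
        C * ∑ j ∈ Finset.range (m + 1), ‖iteratedFDeriv ℝ j g x‖ := by
  obtain ⟨B, hB0, hB⟩ := exists_iteratedFDeriv_bound hχ hc N
  refine ⟨2 ^ N * B, by positivity, fun Ω g hg x hx m hm => ?_⟩
  have h := norm_iteratedFDerivWithin_mul_le (𝕜 := ℝ) (n := m) (N := (⊤ : ℕ∞))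
    (hχ.contDiffOn (s := (Ω : Set (E d)))) hg Ω.isOpen.uniqueDiffOn hx
    (by exact_mod_cast le_top)
  simp only [iteratedFDerivWithin_of_isOpen _ Ω.isOpen hx] at h
  refine h.trans ?_
  rw [← Finset.sum_range_reflect (fun j => ‖iteratedFDeriv ℝ j g x‖), Finset.mul_sum]
  refine Finset.sum_le_sum fun i hi => ?_
  have hi' : i ≤ m := Nat.lt_succ_iff.1 (Finset.mem_range.1 hi)
  have h1 : (m.choose i : ℝ) ≤ 2 ^ N := by
    have : m.choose i ≤ 2 ^ N := (Nat.choose_le_two_pow m i).trans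
      (Nat.pow_le_pow_right (by norm_num) hm)
    exact_mod_cast this
  have h2 : m + 1 - 1 - i = m - i := by omega
  rw [h2]
  gcongr
  exact hB i (hi'.trans hm) x

/-- The derivatives of `χ ρ` are controlled by those of `ρ`. -/
theorem exists_mul_bound {χ : E d → ℂ} (hχ : ContDiff ℝ (⊤ : ℕ∞) χ) (hc : HasCompactSupport χ)
    (N : ℕ) : ∃ C : ℝ, 0 ≤ C ∧ ∀ ρ : E d → ℂ, ContDiff ℝ (⊤ : ℕ∞) ρ → ∀ M : ℝ, 0 ≤ M →
      (∀ i ≤ N, ∀ x, ‖iteratedFDeriv ℝ i ρ x‖ ≤ M) →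
        ∀ i ≤ N, ∀ x, ‖iteratedFDeriv ℝ i (fun y => χ y * ρ y) x‖ ≤ C * M := by
  obtain ⟨C, hC0, hC⟩ := exists_leibniz_bound hχ hc N
  refine ⟨C * (N + 1), by positivity, fun ρ hρ M hM h i hi x => ?_⟩
  refine (hC ⊤ ρ hρ.contDiffOn x (by trivial) i hi).trans ?_
  rw [mul_assoc]
  gcongr
  calc ∑ j ∈ Finset.range (i + 1), ‖iteratedFDeriv ℝ j ρ x‖
      ≤ ∑ j ∈ Finset.range (i + 1), M := Finset.sum_le_sum fun j hj =>
        h j ((Nat.lt_succ_iff.1 (Finset.mem_range.1 hj)).trans hi) x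
    _ = (i + 1) * M := by simp
    _ ≤ (N + 1) * M := by gcongr

theorem contDiff_mul_of_tsupport_subset {Ω : Opens (E d)} {χ g : E d → ℂ}
    (hχ : ContDiff ℝ (⊤ : ℕ∞) χ) (hs : tsupport χ ⊆ Ω) (hg : ContDiffOn ℝ (⊤ : ℕ∞) g Ω) :
    ContDiff ℝ (⊤ : ℕ∞) (fun x => χ x * g x) := by
  rw [contDiff_iff_contDiffAt]
  intro x
  by_cases hx : x ∈ tsupport χ
  · exact hχ.contDiffAt.mul (hg.contDiffAt (Ω.isOpen.mem_nhds (hs hx)))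
  · have h0 : χ =ᶠ[nhds x] 0 := notMem_tsupport_iff_eventuallyEq.1 hx
    have : (fun y => χ y * g y) =ᶠ[nhds x] fun _ => 0 := by
      filter_upwards [h0] with y hy
      simp [hy]
    exact contDiffAt_const.congr_of_eventuallyEq this

/-- A continuous function on an open set is bounded pointwise by its essential supremum. -/
theorem enorm_le_eLpNorm_top {ω : Opens (E d)} {h : E d → ℂ} (hh : ContinuousOn h ω) {x : E d}
    (hx : x ∈ ω) : ‖h x‖ₑ ≤ eLpNorm h ∞ (volume.restrict (ω : Set (E d))) := by
  by_contra! hlt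
  have hopen : IsOpen ((ω : Set (E d)) ∩
      {y | eLpNorm h ∞ (volume.restrict (ω : Set (E d))) < ‖h y‖ₑ}) :=
    (continuous_enorm.comp_continuousOn hh).isOpen_inter_preimage ω.isOpen isOpen_Ioi
  have hpos := hopen.measure_pos volume ⟨x, hx, hlt⟩
  have hae := ae_le_eLpNormEssSup (f := h) (μ := volume.restrict (ω : Set (E d)))
  rw [← eLpNorm_exponent_top, ae_restrict_iff' ω.isOpen.measurableSet, ae_iff] at hae
  refine hpos.ne' (measure_mono_null (fun y hy => ?_) hae)
  simp only [mem_ofPred_eq, Classical.not_imp, not_le]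
  exact hy

theorem exists_enorm_leibniz_bound {χ : E d → ℂ} (hχ : ContDiff ℝ (⊤ : ℕ∞) χ)
    (hc : HasCompactSupport χ) (m : ℕ) :
    ∃ C : ℝ≥0, ∀ (ω : Opens (E d)) (g : E d → ℂ), ContDiffOn ℝ (⊤ : ℕ∞) g ω → ∀ x ∈ ω,
      ‖iteratedFDeriv ℝ m (fun y => χ y * g y) x‖ₑ ≤
        C * ∑ j ∈ Finset.range (m + 1), ∑ w : Fin j → Fin d, ‖pderiv j w g x‖ₑ := by
  obtain ⟨C, hC0, hC⟩ := exists_leibniz_bound hχ hc m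
  lift C to ℝ≥0 using hC0
  refine ⟨C, fun ω g hg x hx => ?_⟩
  have h : ‖iteratedFDeriv ℝ m (fun y => χ y * g y) x‖₊ ≤ C *
      ∑ j ∈ Finset.range (m + 1), ∑ w : Fin j → Fin d, ‖pderiv j w g x‖₊ := by
    rw [← NNReal.coe_le_coe]
    push_cast
    refine (hC ω g hg x hx m le_rfl).trans ?_
    gcongr with j hj
    exact norm_iteratedFDeriv_le_sum_pderiv g x
  calc ‖iteratedFDeriv ℝ m (fun y => χ y * g y) x‖ₑ
      ≤ ((C * ∑ j ∈ Finset.range (m + 1), ∑ w : Fin j → Fin d,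
          ‖pderiv j w g x‖₊ : ℝ≥0) : ℝ≥0∞) := by
        exact_mod_cast h
    _ = _ := by push_cast; rfl

theorem iteratedFDeriv_mul_eq_zero {χ g : E d → ℂ} {x : E d} (hx : x ∉ tsupport χ) (m : ℕ) :
    iteratedFDeriv ℝ m (fun y => χ y * g y) x = 0 := by
  by_contra hne
  exact hx (tsupport_mul_subset_left (f := χ) (g := g)
    ((support_iteratedFDeriv_subset (𝕜 := ℝ) m) hne))

theorem exists_sup_bound {χ : E d → ℂ} (hχ : ContDiff ℝ (⊤ : ℕ∞) χ) (hc : HasCompactSupport χ)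
    {ω : Opens (E d)} (hs : tsupport χ ⊆ ω) (m : ℕ) :
    ∃ C : ℝ≥0, ∀ g : E d → ℂ, ContDiffOn ℝ (⊤ : ℕ∞) g ω → ∀ x,
      ‖iteratedFDeriv ℝ m (fun y => χ y * g y) x‖ₑ ≤ C * sobolevNorm m ∞ ω g := by
  obtain ⟨C, hC⟩ := exists_enorm_leibniz_bound hχ hc m
  refine ⟨C * ∑ j ∈ Finset.range (m + 1), ∑ w : Fin j → Fin d, 1, fun g hg x => ?_⟩
  by_cases hx : x ∈ tsupport χ
  · refine (hC ω g hg x (hs hx)).trans ?_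
    push_cast
    rw [mul_assoc]
    gcongr
    simp only [Finset.sum_mul, one_mul]
    refine Finset.sum_le_sum fun j hj => Finset.sum_le_sum fun w _ => ?_
    exact (enorm_le_eLpNorm_top (continuousOn_pderiv hg j w) (hs hx)).trans
      (le_iSup_of_le j (le_iSup_of_le (Nat.lt_succ_iff.1 (Finset.mem_range.1 hj))
        (le_iSup_of_le w le_rfl)))
  · simp [iteratedFDeriv_mul_eq_zero hx]

theorem exists_lintegral_bound {χ : E d → ℂ} (hχ : ContDiff ℝ (⊤ : ℕ∞) χ)
    (hc : HasCompactSupport χ) {ω : Opens (E d)} (hs : tsupport χ ⊆ ω) (m : ℕ) :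
    ∃ C : ℝ≥0, ∀ g : E d → ℂ, ContDiffOn ℝ (⊤ : ℕ∞) g ω →
      ∫⁻ x, ‖iteratedFDeriv ℝ m (fun y => χ y * g y) x‖ₑ ≤ C * sobolevNorm m 1 ω g := by
  obtain ⟨C, hC⟩ := exists_enorm_leibniz_bound hχ hc m
  refine ⟨C * ∑ j ∈ Finset.range (m + 1), ∑ w : Fin j → Fin d, 1, fun g hg => ?_⟩
  have hmeas : ∀ j (w : Fin j → Fin d),
      AEMeasurable (fun x => ‖pderiv j w g x‖ₑ) (volume.restrict (ω : Set (E d))) := fun j w =>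
    ((continuousOn_pderiv hg j w).aestronglyMeasurable ω.isOpen.measurableSet).enorm
  calc ∫⁻ x, ‖iteratedFDeriv ℝ m (fun y => χ y * g y) x‖ₑ
      = ∫⁻ x in (ω : Set (E d)), ‖iteratedFDeriv ℝ m (fun y => χ y * g y) x‖ₑ := by
        rw [← lintegral_indicator ω.isOpen.measurableSet]
        refine lintegral_congr fun x => ?_
        by_cases hx : x ∈ (ω : Set (E d))
        · rw [indicator_of_mem hx]
        · rw [indicator_of_notMem hx, iteratedFDeriv_mul_eq_zero fun h => hx (hs h), enorm_zero]
    _ ≤ ∫⁻ x in (ω : Set (E d)),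
          C * ∑ j ∈ Finset.range (m + 1), ∑ w : Fin j → Fin d, ‖pderiv j w g x‖ₑ :=
        setLIntegral_mono' ω.isOpen.measurableSet fun x hx => hC ω g hg x hx
    _ = C * ∑ j ∈ Finset.range (m + 1), ∑ w : Fin j → Fin d,
          eLpNorm (pderiv j w g) 1 (volume.restrict (ω : Set (E d))) := by
        rw [lintegral_const_mul' _ _ ENNReal.coe_ne_top, lintegral_finsetSum' _ fun j _ =>
          Finset.aemeasurable_fun_sum _ fun w _ => hmeas j w]
        congr 1
        refine Finset.sum_congr rfl fun j _ => ?_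
        rw [lintegral_finsetSum' _ fun w _ => hmeas j w]
        simp only [eLpNorm_one_eq_lintegral_enorm]
    _ ≤ _ := by
        push_cast
        rw [mul_assoc]
        gcongr
        simp only [Finset.sum_mul, one_mul]
        refine Finset.sum_le_sum fun j hj => Finset.sum_le_sum fun w _ => ?_
        exact le_iSup_of_le j (le_iSup_of_le (Nat.lt_succ_iff.1 (Finset.mem_range.1 hj))
          (le_iSup_of_le w le_rfl))

end Cutoff

/-! ### Convolution with functions having vanishing moments -/

section Moments

variable {d : ℕ}

/-- All moments of order less than `m` of the function `ψ` vanish. -/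
def VanishingMoments (m : ℕ) (ψ : E d → ℂ) : Prop :=
  ∀ α : Fin d → ℕ, ∑ i, α i < m → ∫ t : E d, (∏ i, ((t i : ℝ) : ℂ) ^ α i) * ψ t = 0

theorem prod_word_eq_prod_pow {k : ℕ} (w : Fin k → Fin d) (t : E d) :
    ∏ l, ((t (w l) : ℝ) : ℂ) =
      ∏ i, ((t i : ℝ) : ℂ) ^ (Finset.univ.filter fun l => w l = i).card := by
  rw [← Finset.prod_fiberwise (s := Finset.univ) (g := w)]
  refine Finset.prod_congr rfl fun i _ => ?_
  rw [← Finset.prod_const]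
  exact Finset.prod_congr rfl fun l hl => by rw [(Finset.mem_filter.1 hl).2]

theorem sum_card_fiber {k : ℕ} (w : Fin k → Fin d) :
    ∑ i, (Finset.univ.filter fun l => w l = i).card = k := by
  rw [← Finset.card_eq_sum_card_fiberwise (fun _ _ => Finset.mem_univ _), Finset.card_univ,
    Fintype.card_fin]

theorem integrable_prod_mul (ψ : 𝓢(E d, ℂ)) {k : ℕ} (w : Fin k → Fin d) :
    Integrable (fun t : E d => (∏ l, ((t (w l) : ℝ) : ℂ)) * ψ t) := by
  refine (ψ.integrable_pow_mul volume k).mono' ?_ (Filter.Eventually.of_forall fun t => ?_)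
  · exact (Continuous.mul (by fun_prop) ψ.continuous).aestronglyMeasurable
  · rw [norm_mul, norm_prod]
    gcongr
    calc ∏ l, ‖((t (w l) : ℝ) : ℂ)‖ ≤ ∏ _l : Fin k, ‖t‖ := by
          gcongr with l
          simpa using PiLp.norm_apply_le t (w l)
      _ = ‖t‖ ^ k := by simp

theorem multilinear_diag_mul_eq {k : ℕ} (A : (E d) [×k]→L[ℝ] ℂ) (c : ℝ) (ψ : E d → ℂ) (t : E d) :
    A (fun _ => c • t) * ψ t = ∑ w : Fin k → Fin d,
      ((c : ℂ) ^ k * A (fun l => EuclideanSpace.single (w l) 1)) *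
        ((∏ l, ((t (w l) : ℝ) : ℂ)) * ψ t) := by
  rw [multilinear_apply_eq_sum, Finset.sum_mul]
  refine Finset.sum_congr rfl fun w _ => ?_
  simp only [PiLp.smul_apply, smul_eq_mul, Finset.prod_mul_distrib, Finset.prod_const,
    Finset.card_univ, Fintype.card_fin, Complex.real_smul]
  push_cast
  ring

theorem integrable_multilinear_diag_mul (ψ : 𝓢(E d, ℂ)) {k : ℕ} (A : (E d) [×k]→L[ℝ] ℂ) (c : ℝ) :
    Integrable (fun t : E d => A (fun _ => c • t) * ψ t) := by
  simp only [multilinear_diag_mul_eq A c ψ]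
  exact integrable_finsetSum _ fun w _ => (integrable_prod_mul ψ w).const_mul _

theorem integral_multilinear_diag_mul (ψ : 𝓢(E d, ℂ)) {k m : ℕ} (hψ : VanishingMoments m ψ)
    (hk : k < m) (A : (E d) [×k]→L[ℝ] ℂ) (c : ℝ) :
    ∫ t : E d, A (fun _ => c • t) * ψ t = 0 := by
  simp only [multilinear_diag_mul_eq A c ψ]
  rw [integral_finsetSum _ fun w _ => (integrable_prod_mul ψ w).const_mul _]
  refine Finset.sum_eq_zero fun w _ => ?_
  rw [integral_const_mul]
  simp only [prod_word_eq_prod_pow w]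
  rw [hψ _ (by rwa [sum_card_fiber]), mul_zero]

/-- The Taylor remainder of order `m` is bounded by the derivatives of order `m`. -/
theorem norm_sub_taylor_le {g : E d → ℂ} (hg : ContDiff ℝ (⊤ : ℕ∞) g) {m : ℕ} {A : ℝ}
    (hA : ∀ x, ‖iteratedFDeriv ℝ m g x‖ ≤ A) (x y : E d) :
    ‖g (x + y) - ∑ k ∈ Finset.range m,
      ((k.factorial : ℝ)⁻¹ • iteratedFDeriv ℝ k g x fun _ => y)‖ ≤ A * ‖y‖ ^ m := by
  have hD : ∀ z, ‖iteratedFDeriv ℝ m g z fun _ => y‖ ≤ A * ‖y‖ ^ m := fun z => by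
    refine (ContinuousMultilinearMap.le_opNorm _ _).trans ?_
    simp only [Finset.prod_const, Finset.card_univ, Fintype.card_fin]
    gcongr
    exact hA z
  have hA0 : 0 ≤ A := (norm_nonneg _).trans (hA x)
  cases m with
  | zero => simpa using hD (x + y)
  | succ n =>
    rw [map_add_eq_sum_add_integral_iteratedFDeriv (n := n) fun t _ =>
      (hg.contDiffAt).of_le (by exact_mod_cast le_top), add_sub_cancel_left, norm_smul]
    have h1 : ‖∫ t in (0 : ℝ)..1, (1 - t) ^ n •
        iteratedFDeriv ℝ (n + 1) g (x + t • y) fun _ => y‖ ≤ A * ‖y‖ ^ (n + 1) * |1 - 0| := by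
      refine intervalIntegral.norm_integral_le_of_norm_le_const fun t ht => ?_
      rw [uIoc_of_le zero_le_one] at ht
      rw [norm_smul, norm_pow, Real.norm_of_nonneg (by linarith [ht.2])]
      exact (mul_le_of_le_one_left (norm_nonneg _)
        (pow_le_one₀ (by linarith [ht.2]) (by linarith [ht.1]))).trans (hD _)
    have h2 : ‖((n.factorial : ℝ)⁻¹)‖ ≤ 1 := by
      rw [norm_inv, Real.norm_natCast]
      exact inv_le_one_of_one_le₀ (by exact_mod_cast n.factorial_pos)
    calc _ ≤ 1 * (A * ‖y‖ ^ (n + 1) * |1 - 0|) := by gcongr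
      _ = _ := by simp

/-- Convolution at scale `y` with a function having vanishing moments of order less than `m`
gains a factor `y ^ m` on functions with bounded derivatives of order `m`. -/
theorem norm_integral_mul_dilate_le (ψ : 𝓢(E d, ℂ)) {m : ℕ} (hψ : VanishingMoments m ψ)
    {g : E d → ℂ} (hg : ContDiff ℝ (⊤ : ℕ∞) g) (hc : HasCompactSupport g) {A : ℝ}
    (hA : ∀ x, ‖iteratedFDeriv ℝ m g x‖ ≤ A) {y : ℝ} (hy : 0 < y) (x : E d) :
    ‖∫ z, g z * dilate ψ y (x - z)‖ ≤ (∫ t, ‖t‖ ^ m * ‖ψ t‖) * y ^ m * A := by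
  have hA0 : 0 ≤ A := (norm_nonneg _).trans (hA x)
  have h1 : ∫ z, g z * dilate ψ y (x - z) = ∫ t, g (x + (-y) • t) * ψ t := by
    have e1 : ∫ z, g z * dilate ψ y (x - z) = ∫ w, g (x - w) * dilate ψ y w := by
      rw [← integral_sub_left_eq_self _ volume x]
      simp
    have e2 : ∀ w, g (x - w) * dilate ψ y w =
        ((y ^ d)⁻¹ : ℝ) • (fun t => g (x + (-y) • t) * ψ t) (y⁻¹ • w) := by
      intro w
      simp only [dilate_apply ψ hy.ne', smul_smul, Complex.real_smul]
      rw [neg_mul, mul_inv_cancel₀ hy.ne', neg_one_smul, ← sub_eq_add_neg]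
      ring
    rw [e1]
    rw [integral_congr_ae (Filter.Eventually.of_forall e2), integral_smul,
      Measure.integral_comp_inv_smul volume (fun t => g (x + (-y) • t) * ψ t) y, smul_smul,
      finrank_euclideanSpace_fin,
      abs_of_pos (by positivity), inv_mul_cancel₀ (by positivity), one_smul]
  set P : E d → ℂ := fun t => ∑ k ∈ Finset.range m,
    ((k.factorial : ℝ)⁻¹ • iteratedFDeriv ℝ k g x fun _ => (-y) • t)
  have hPeq : ∀ t, P t * ψ t = ∑ k ∈ Finset.range m, ((k.factorial : ℝ)⁻¹ : ℂ) *
      ((iteratedFDeriv ℝ k g x fun _ => (-y) • t) * ψ t) := by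
    intro t
    simp only [P, Finset.sum_mul, Complex.real_smul]
    refine Finset.sum_congr rfl fun k _ => ?_
    push_cast
    ring
  have hPint : Integrable fun t => P t * ψ t := by
    simp only [hPeq]
    exact integrable_finsetSum _ fun k _ => (integrable_multilinear_diag_mul ψ _ _).const_mul _
  have hP0 : ∫ t, P t * ψ t = 0 := by
    simp only [hPeq]
    rw [integral_finsetSum _ fun k _ => (integrable_multilinear_diag_mul ψ _ _).const_mul _]
    refine Finset.sum_eq_zero fun k hk => ?_
    rw [integral_const_mul, integral_multilinear_diag_mul ψ hψ (Finset.mem_range.1 hk), mul_zero]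
  have hgint : Integrable fun t => g (x + (-y) • t) * ψ t := by
    obtain ⟨B, hB⟩ := hg.continuous.bounded_above_of_compact_support hc
    have hgc := hg.continuous
    exact ψ.integrable.bdd_mul (c := B)
      (by fun_prop : Continuous fun t => g (x + (-y) • t)).aestronglyMeasurable
      (Filter.Eventually.of_forall fun t => hB _)
  rw [h1, ← sub_zero (∫ t, g (x + (-y) • t) * ψ t), ← hP0, ← integral_sub hgint hPint]
  have hbound : ∀ t, ‖g (x + (-y) • t) * ψ t - P t * ψ t‖ ≤ y ^ m * A * (‖t‖ ^ m * ‖ψ t‖) := by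
    intro t
    rw [← sub_mul, norm_mul]
    calc ‖g (x + (-y) • t) - P t‖ * ‖ψ t‖ ≤ (A * ‖(-y) • t‖ ^ m) * ‖ψ t‖ := by
          gcongr
          exact norm_sub_taylor_le hg hA x _
      _ = _ := by
          rw [norm_smul, norm_neg, Real.norm_of_nonneg hy.le, mul_pow]
          ring
  refine (norm_integral_le_of_norm_le ((ψ.integrable_pow_mul volume m).const_mul _)
    (Filter.Eventually.of_forall hbound)).trans (le_of_eq ?_)
  rw [integral_const_mul]
  ring

end Moments

/-! ### The interpolation estimate -/

section Interpolation

variable {d : ℕ} {Ω : Opens (E d)}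

/-- The dyadic averages of `|⟨T - u_ε, ρ⟩|` are `O(δ ^ b)` for test functions `ρ` supported in `K`,
uniformly as long as the derivatives of `ρ` of order at most `N` are bounded. -/
def UniformlyAssociated (T : 𝓓'(Ω, ℂ)) (u : ℝ → E d → ℂ) (K : Set (E d)) (b : ℝ) (N : ℕ) : Prop :=
  ∃ C : ℝ, 0 ≤ C ∧ ∀ ρ : 𝓓(Ω, ℂ), tsupport ρ ⊆ K → ∀ M : ℝ, 0 ≤ M →
    (∀ i ≤ N, ∀ x, ‖iteratedFDeriv ℝ i ρ x‖ ≤ M) → ∀ δ ∈ Ioo (0 : ℝ) (1 / 2),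
      ∫⁻ ε in Icc δ (2 * δ), ‖defect T u ε ρ‖ₑ ≤ ENNReal.ofReal (C * M * δ ^ (b + 1))

theorem integrable_mul_test {ω : Opens (E d)} {g ρ : E d → ℂ} (hg : ContDiffOn ℝ (⊤ : ℕ∞) g ω)
    (hρ : ContDiff ℝ (⊤ : ℕ∞) ρ) (hc : HasCompactSupport ρ) (hs : tsupport ρ ⊆ ω) :
    Integrable fun x => g x * ρ x := by
  simp only [mul_comm (g _)]
  exact (contDiff_mul_of_tsupport_subset hρ hs hg).continuous.integrable_of_hasCompactSupport
    hc.mul_right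

/-- Balancing the rate of association against the growth of a representative. -/
theorem UniformlyAssociated.exists_norm_pair_le {p q r : ℝ≥0∞} [Fact (1 ≤ p)] [Fact (1 ≤ q)]
    {T : 𝓓'(Ω, ℂ)} {u : ℝ → E d → ℂ} {K : Set (E d)} {b : ℝ} {N : ℕ}
    (h : UniformlyAssociated T u K b N) (hu : SmoothNet Ω u) {ω₁ ω₂ : Opens (E d)}
    (hω₂ : CompactlyIn ω₂ ω₁) (hK : K ⊆ ω₂) {v : ℝ → E d → ℂ}
    (hv : SmoothNet ω₁ v) (huv : IsNegligible p q ω₁ (u - v)) {k : ℕ} {s : ℝ}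
    (hgr : Growth r q k s ω₂ v) :
    ∃ C : ℝ, 0 ≤ C ∧ ∀ ρ : 𝓓(Ω, ℂ), tsupport ρ ⊆ K → ∀ M : ℝ, 0 ≤ M →
      (∀ i ≤ N, ∀ x, ‖iteratedFDeriv ℝ i ρ x‖ ≤ M) → ∀ B : ℝ, 0 ≤ B →
      ∀ δ ∈ Ioo (0 : ℝ) (1 / 2),
      (∀ ε ∈ Icc δ (2 * δ), ‖∫ x, v ε x * ρ x‖ₑ ≤
        ENNReal.ofReal B * sobolevNorm k r ω₂ (v ε)) →
      ‖pair T ρ‖ ≤ C * (M * δ ^ b + B * δ ^ (-s)) := by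
  obtain ⟨C₁, hC₁0, hC₁⟩ := h
  obtain ⟨C₂, hC₂0, hC₂⟩ := huv.exists_lintegral_le hω₂ b
  obtain ⟨C₃, hC₃0, hC₃⟩ := LqFinite.exists_lintegral_Icc_le (b := -s)
    (h := fun ε => sobolevNorm k r ω₂ (v ε)) (by rw [neg_neg]; exact hgr)
  refine ⟨C₁ + C₂ + C₃, by positivity, fun ρ hρ M hM hi B hB δ hδ hvB => ?_⟩
  have hδ0 := hδ.1
  have hmem : ∀ ε ∈ Icc δ (2 * δ), ε ∈ Ioo (0 : ℝ) 1 := fun ε hε => mem_Ioo_of_mem_Icc hδ hε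
  have hρω₁ : tsupport ρ ⊆ ω₁ := (hρ.trans hK).trans hω₂.le
  set a₁ : ℝ → ℝ≥0∞ := fun ε => ‖defect T u ε ρ‖ₑ
  set a₂ : ℝ → ℝ≥0∞ := fun ε => ‖∫ x, (u - v) ε x * ρ x‖ₑ
  set a₃ : ℝ → ℝ≥0∞ := fun ε => ENNReal.ofReal B * sobolevNorm k r ω₂ (v ε)
  have hpt : ∀ ε ∈ Icc δ (2 * δ), ‖pair T ρ‖ₑ ≤ a₁ ε + (a₂ ε + a₃ ε) := by
    intro ε hε
    have e : pair T ρ = defect T u ε ρ + ((∫ x, (u - v) ε x * ρ x) + ∫ x, v ε x * ρ x) := by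
      have hi1 := integrable_mul_test (hu.1 ε (hmem ε hε)) ρ.contDiff ρ.hasCompactSupport
        ρ.tsupport_subset
      have hi2 := integrable_mul_test (hv.1 ε (hmem ε hε)) ρ.contDiff ρ.hasCompactSupport hρω₁
      have : ∫ x, (u - v) ε x * ρ x = (∫ x, u ε x * ρ x) - ∫ x, v ε x * ρ x := by
        rw [← integral_sub hi1 hi2]
        simp only [Pi.sub_apply, sub_mul]
      rw [this, defect]
      ring
    rw [e]
    exact (enorm_add_le _ _).trans (add_le_add le_rfl ((enorm_add_le _ _).trans
      (add_le_add le_rfl (hvB ε hε))))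
  have hm₁ : AEMeasurable a₁ (volume.restrict (Icc δ (2 * δ))) :=
    (((hu.continuousOn_defect T ρ).mono hmem).aestronglyMeasurable measurableSet_Icc).enorm
  have hm₂ : AEMeasurable a₂ (volume.restrict (Icc δ (2 * δ))) := by
    have h := huv.1.continuousOn_integral_mul (Y := Unit) (G := fun _ => ρ) ρ.hasCompactSupport
      hρω₁ (ρ.continuous.comp continuous_snd)
      fun _ x hx => image_eq_zero_of_notMem_tsupport hx
    have h' : ContinuousOn (fun ε : ℝ => ∫ x, (u - v) ε x * ρ x) (Icc δ (2 * δ)) :=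
      h.comp (f := fun ε : ℝ => (ε, ())) (by fun_prop) fun ε hε => ⟨hmem ε hε, mem_univ _⟩
    exact (h'.aestronglyMeasurable measurableSet_Icc).enorm
  have hmain : ENNReal.ofReal (‖pair T ρ‖ * δ) ≤
      ENNReal.ofReal ((C₁ + C₂ + C₃) * (M * δ ^ b + B * δ ^ (-s)) * δ) := by
    calc ENNReal.ofReal (‖pair T ρ‖ * δ) = ∫⁻ ε in Icc δ (2 * δ), ‖pair T ρ‖ₑ := by
          rw [setLIntegral_const, Real.volume_Icc, ENNReal.ofReal_mul (norm_nonneg _), ofReal_norm]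
          congr 2; ring
      _ ≤ ∫⁻ ε in Icc δ (2 * δ), (a₁ ε + (a₂ ε + a₃ ε)) :=
          setLIntegral_mono' measurableSet_Icc hpt
      _ = (∫⁻ ε in Icc δ (2 * δ), a₁ ε) + ((∫⁻ ε in Icc δ (2 * δ), a₂ ε) +
            ENNReal.ofReal B * ∫⁻ ε in Icc δ (2 * δ), sobolevNorm k r ω₂ (v ε)) := by
          rw [lintegral_add_left' hm₁, lintegral_add_left' hm₂,
            lintegral_const_mul' _ _ ENNReal.ofReal_ne_top]
      _ ≤ ENNReal.ofReal (C₁ * M * δ ^ (b + 1)) + (ENNReal.ofReal (C₂ * M * δ ^ (b + 1)) +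
            ENNReal.ofReal B * ENNReal.ofReal (C₃ * δ ^ (-s + 1))) := by
          gcongr
          · exact hC₁ ρ hρ M hM hi δ hδ
          · exact hC₂ ρ ((subset_tsupport _).trans (hρ.trans hK)) M hM
              (fun x => by simpa using hi 0 (Nat.zero_le _) x) δ hδ
          · exact hC₃ δ hδ
      _ = ENNReal.ofReal (C₁ * M * δ ^ (b + 1) + (C₂ * M * δ ^ (b + 1) +
            B * (C₃ * δ ^ (-s + 1)))) := by
          rw [← ENNReal.ofReal_mul hB, ← ENNReal.ofReal_add (by positivity) (by positivity),
            ← ENNReal.ofReal_add (by positivity) (by positivity)]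
      _ ≤ _ := by
          apply ENNReal.ofReal_le_ofReal
          rw [Real.rpow_add_one hδ0.ne', Real.rpow_add_one hδ0.ne']
          have : 0 ≤ C₃ * (M * δ ^ b) * δ := by positivity
          have : 0 ≤ (C₁ + C₂) * (B * δ ^ (-s)) * δ := by positivity
          linarith
  rw [ENNReal.ofReal_le_ofReal_iff (by positivity)] at hmain
  exact le_of_mul_le_mul_right hmain hδ0

/-- A strongly associated representative is uniformly associated on compact sets. -/
theorem exists_uniformlyAssociated {q : ℝ≥0∞} [Fact (1 ≤ q)] {T : 𝓓'(Ω, ℂ)} {u : ℝ → E d → ℂ}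
    (hu : SmoothNet Ω u) {b : ℝ} {ω : Opens (E d)}
    (h : ∀ ρ : 𝓓(Ω, ℂ), tsupport ρ ⊆ ω →
      LqFinite q (fun ε => ENNReal.ofReal (ε ^ (-b)) * ‖pair T ρ - ∫ x, u ε x * ρ x‖ₑ))
    {K : Set (E d)} (hK : IsCompact K) (hKω : K ⊆ ω) (hKΩ : K ⊆ Ω) :
    ∃ N : ℕ, UniformlyAssociated T u K b N :=
  exists_uniform_defect_bound T hu hK hKΩ fun ρ hρ =>
    LqFinite.exists_lintegral_Icc_le (h ρ (hρ.trans hKω))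

theorem exists_compactlyIn {K : Set (E d)} (hK : IsCompact K) (hKΩ : K ⊆ Ω) :
    ∃ ω : Opens (E d), K ⊆ ω ∧ CompactlyIn ω Ω := by
  obtain ⟨V, hVo, hKV, hVΩ, hVc⟩ := exists_open_between_and_isCompact_closure hK Ω.isOpen hKΩ
  exact ⟨⟨V, hVo⟩, hKV, hVc, hVΩ⟩

end Interpolation

/-! ### Localization and convolution -/

section Zygmund

variable {d : ℕ} {Ω : Opens (E d)}

/-- The test function `χ ρ` for a test function `χ` and a smooth function `ρ`. -/
noncomputable def mulSmooth (χ : 𝓓(Ω, ℂ)) (ρ : E d → ℂ) (hρ : ContDiff ℝ (⊤ : ℕ∞) ρ) :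
    𝓓(Ω, ℂ) where
  toFun := fun x => χ x * ρ x
  contDiff' := χ.contDiff.mul hρ
  hasCompactSupport' := χ.hasCompactSupport.mul_right
  tsupport_subset' := (tsupport_mul_subset_left (f := χ) (g := ρ)).trans χ.tsupport_subset

@[simp]
theorem mulSmooth_apply (χ : 𝓓(Ω, ℂ)) (ρ : E d → ℂ) (hρ : ContDiff ℝ (⊤ : ℕ∞) ρ) (x : E d) :
    mulSmooth χ ρ hρ x = χ x * ρ x := rfl

theorem tsupport_mulSmooth_subset (χ : 𝓓(Ω, ℂ)) (ρ : E d → ℂ) (hρ : ContDiff ℝ (⊤ : ℕ∞) ρ) :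
    tsupport (mulSmooth χ ρ hρ) ⊆ tsupport χ :=
  tsupport_mul_subset_left (f := χ) (g := ρ)

@[simp]
theorem mulTest_apply (χ : 𝓓(Ω, ℂ)) (ρ : 𝓢(E d, ℂ)) (x : E d) : mulTest χ ρ x = χ x * ρ x := rfl

/-- The localization `χ T` as a tempered distribution. -/
theorem exists_tempered (T : 𝓓'(Ω, ℂ)) (χ : 𝓓(Ω, ℂ)) :
    ∃ S : 𝓢'(E d, ℂ), ∀ ρ : 𝓢(E d, ℂ), S ρ = pair T (mulTest χ ρ) := by
  obtain ⟨N, C, hC0, hC⟩ := exists_norm_pair_le T χ.hasCompactSupport χ.tsupport_subset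
  obtain ⟨D, hD0, hD⟩ := exists_mul_bound χ.contDiff χ.hasCompactSupport N
  let A : 𝓢(E d, ℂ) →L[ℂ] ℂ := SchwartzMap.mkCLMtoNormedSpace (𝕜 := ℂ) (σ := RingHom.id ℂ)
    (fun ρ => pair T (mulTest χ ρ))
    (fun ρ σ => by
      rw [← pair_add]
      congr 1
      ext x
      simp [mul_add])
    (fun c ρ => by
      rw [RingHom.id_apply, smul_eq_mul, ← pair_smul]
      congr 1
      ext x
      simp [mul_left_comm])
    (by
      refine ⟨(Finset.range (N + 1)).image fun i => (0, i), C * D, by positivity, fun ρ => ?_⟩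
      rw [mul_assoc]
      refine hC _ (tsupport_mulSmooth_subset χ ρ (ρ.smooth _)) _ (by positivity)
        (hD ρ (ρ.smooth _) _ (apply_nonneg _ _) fun i hi x => ?_)
      refine (SchwartzMap.norm_iteratedFDeriv_le_seminorm ℂ ρ i x).trans ?_
      refine Seminorm.le_finset_sup_apply (p := schwartzSeminormFamily ℂ (E d) ℂ) (i := (0, i)) ?_
      exact Finset.mem_image_of_mem _ (Finset.mem_range.2 (Nat.lt_succ_of_le hi)))
  exact ⟨ContinuousLinearMap.toPointwiseConvergenceCLM _ _ _ _ A, fun ρ => rfl⟩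

/-- The functions `ψ_y(x - ·)` have derivatives of order at most `N` bounded by a multiple of
`y ^ (-(d + N))`, uniformly in `x`. -/
theorem exists_kernel_bound (ψ : 𝓢(E d, ℂ)) (N : ℕ) :
    ∃ B : ℝ, 0 ≤ B ∧ ∀ y ∈ Ioc (0 : ℝ) 1, ∀ x : E d, ∀ i ≤ N, ∀ z,
      ‖iteratedFDeriv ℝ i (fun z => dilate ψ y (x - z)) z‖ ≤ B * y ^ (-((d : ℝ) + N)) := by
  have hb : ∀ i, ∀ x, ‖iteratedFDeriv ℝ i ψ x‖ ≤ SchwartzMap.seminorm ℝ 0 i ψ := fun i x =>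
    SchwartzMap.norm_iteratedFDeriv_le_seminorm ℝ ψ i x
  refine ⟨∑ i ∈ Finset.range (N + 1), SchwartzMap.seminorm ℝ 0 i ψ, by positivity,
    fun y hy x i hi z => ?_⟩
  have hy0 := hy.1
  set L : E d →L[ℝ] E d := (-y⁻¹) • ContinuousLinearMap.id ℝ (E d)
  set h : E d → ℂ := fun w => ψ (y⁻¹ • x + w)
  have hh : ContDiff ℝ (⊤ : ℕ∞) h := (ψ.smooth _).comp (contDiff_const.add contDiff_id)
  have heq : (fun z => dilate ψ y (x - z)) = ((y ^ d)⁻¹ : ℝ) • (h ∘ L) := by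
    funext z
    simp only [dilate_apply ψ hy0.ne', h, L, Pi.smul_apply, Function.comp, Complex.real_smul]
    congr 2
    simp [sub_eq_add_neg]
  have hi' : ((i : ℕ∞) : WithTop ℕ∞) ≤ ((⊤ : ℕ∞) : WithTop ℕ∞) := by exact_mod_cast le_top
  rw [heq, iteratedFDeriv_const_smul_apply ((hh.comp L.contDiff).contDiffAt.of_le hi'),
    norm_smul, L.iteratedFDeriv_comp_right hh z hi']
  have hL : ‖L‖ ≤ y⁻¹ := by
    refine (norm_smul_le (-y⁻¹) (ContinuousLinearMap.id ℝ (E d))).trans ?_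
    rw [norm_neg, norm_inv, Real.norm_of_nonneg hy0.le]
    exact mul_le_of_le_one_right (by positivity) ContinuousLinearMap.norm_id_le
  have h1 : ‖(iteratedFDeriv ℝ i h (L z)).compContinuousLinearMap fun _ => L‖ ≤
      (∑ i ∈ Finset.range (N + 1), SchwartzMap.seminorm ℝ 0 i ψ) * y⁻¹ ^ i := by
    refine (ContinuousMultilinearMap.norm_compContinuousLinearMap_le _ _).trans ?_
    rw [Finset.prod_const, Finset.card_univ, Fintype.card_fin]
    gcongr
    have : iteratedFDeriv ℝ i h (L z) = iteratedFDeriv ℝ i ψ (y⁻¹ • x + L z) :=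
      iteratedFDeriv_comp_add_left i (y⁻¹ • x) (L z)
    rw [this]
    exact (hb i _).trans (Finset.single_le_sum (f := fun i => SchwartzMap.seminorm ℝ 0 i ψ)
      (fun i _ => apply_nonneg _ _) (Finset.mem_range.2 (Nat.lt_succ_of_le hi)))
  rw [Real.norm_of_nonneg (by positivity)]
  calc (y ^ d)⁻¹ * ‖(iteratedFDeriv ℝ i h (L z)).compContinuousLinearMap fun _ => L‖
      ≤ (y ^ d)⁻¹ * ((∑ i ∈ Finset.range (N + 1), SchwartzMap.seminorm ℝ 0 i ψ) * y⁻¹ ^ N) := by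
        gcongr
        refine h1.trans ?_
        gcongr
        · exact (one_le_inv₀ hy0).2 hy.2
    _ = _ := by
        rw [Real.rpow_neg hy0.le, Real.rpow_add hy0, Real.rpow_natCast, Real.rpow_natCast]
        rw [inv_pow, mul_inv]
        ring

theorem conv_apply_eq {T : 𝓓'(Ω, ℂ)} {χ : 𝓓(Ω, ℂ)} {S : 𝓢'(E d, ℂ)}
    (hS : ∀ ρ : 𝓢(E d, ℂ), S ρ = pair T (mulTest χ ρ)) (ψ : 𝓢(E d, ℂ)) (x : E d)
    (hψ : ContDiff ℝ (⊤ : ℕ∞) fun z => ψ (x - z)) :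
    conv S ψ x = pair T (mulSmooth χ (fun z => ψ (x - z)) hψ) := by
  rw [conv, hS]
  congr 1
  ext z
  rw [mulTest_apply, conv_kernel_apply, mulSmooth_apply]

theorem contDiff_kernel (ψ : 𝓢(E d, ℂ)) (x : E d) :
    ContDiff ℝ (⊤ : ℕ∞) fun z => ψ (x - z) :=
  (ψ.smooth _).comp (contDiff_const.sub contDiff_id)

end Zygmund

/-! ### Hölder–Zygmund regularity of the limit -/

section ZygmundRegularity

variable {d : ℕ} {Ω : Opens (E d)}

theorem IsLPPair.vanishingMoments {r : ℝ} {φ ψ : 𝓢(E d, ℂ)} (h : IsLPPair r φ ψ) :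
    VanishingMoments (⌊r⌋ + 1).toNat ψ :=
  fun α hα => h.2 α (by omega)

theorem sobolevNorm_mono_order {m k : ℕ} (h : m ≤ k) (p : ℝ≥0∞) (ω : Opens (E d)) (g : E d → ℂ) :
    sobolevNorm m p ω g ≤ sobolevNorm k p ω g :=
  iSup_le fun j => iSup_le fun hj => le_iSup_of_le j (le_iSup_of_le (hj.trans h) le_rfl)

/-- A smooth function convolved with a kernel having vanishing moments, in terms of Sobolev norms
on a neighbourhood of the support of the cutoff function. -/
theorem exists_smoothing_bound (χ : 𝓓(Ω, ℂ)) {ω : Opens (E d)} (hs : tsupport χ ⊆ ω)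
    (ψ : 𝓢(E d, ℂ)) {m : ℕ} (hψ : VanishingMoments m ψ) :
    ∃ D : ℝ, 0 ≤ D ∧ ∀ g : E d → ℂ, ContDiffOn ℝ (⊤ : ℕ∞) g ω → ∀ y : ℝ, 0 < y → ∀ x : E d,
      ‖∫ z, g z * mulSmooth χ _ (contDiff_kernel (dilate ψ y) x) z‖ₑ ≤
        ENNReal.ofReal (D * y ^ m) * sobolevNorm m ∞ ω g := by
  obtain ⟨C, hC⟩ := exists_sup_bound χ.contDiff χ.hasCompactSupport hs m
  set I := ∫ t, ‖t‖ ^ m * ‖ψ t‖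
  have hI : 0 ≤ I := integral_nonneg fun t => by positivity
  -- Adding `1` keeps the bound meaningful when the Sobolev norm is infinite.
  refine ⟨I * C + 1, by positivity, fun g hg y hy x => ?_⟩
  rcases eq_or_ne (sobolevNorm m ∞ ω g) ∞ with htop | htop
  · rw [htop, ENNReal.mul_top]
    · exact le_top
    · rw [Ne, ENNReal.ofReal_eq_zero, not_le]
      positivity
  · set A : ℝ := C * (sobolevNorm m ∞ ω g).toReal
    have hA : ∀ x, ‖iteratedFDeriv ℝ m (fun z => χ z * g z) x‖ ≤ A := by
      intro x
      have h := ENNReal.toReal_mono (ENNReal.mul_ne_top ENNReal.coe_ne_top htop) (hC g hg x)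
      rwa [toReal_enorm, ENNReal.toReal_mul, ENNReal.coe_toReal] at h
    have h := norm_integral_mul_dilate_le ψ hψ
      (contDiff_mul_of_tsupport_subset χ.contDiff hs hg) χ.hasCompactSupport.mul_right hA hy x
    have heq : ∫ z, g z * mulSmooth χ _ (contDiff_kernel (dilate ψ y) x) z =
        ∫ z, χ z * g z * dilate ψ y (x - z) := by
      refine integral_congr_ae (Filter.Eventually.of_forall fun z => ?_)
      simp only [mulSmooth_apply]
      ring
    rw [heq, ← ofReal_norm]
    conv_rhs => rw [← ENNReal.ofReal_toReal htop]
    rw [← ENNReal.ofReal_mul (by positivity)]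
    refine ENNReal.ofReal_le_ofReal (h.trans ?_)
    have : 0 ≤ y ^ m * (sobolevNorm m ∞ ω g).toReal := by positivity
    change I * y ^ m * (C * (sobolevNorm m ∞ ω g).toReal) ≤
      (I * C + 1) * y ^ m * (sobolevNorm m ∞ ω g).toReal
    nlinarith

theorem dilate_one (φ : 𝓢(E d, ℂ)) : dilate φ 1 = φ := by
  ext x
  simp [dilate_apply φ one_ne_zero]

/-- If all `L^∞` growth exponents of order `k` can be taken arbitrarily small, the limit
distribution has Hölder–Zygmund regularity `k - s` for every `s > 0`: at scale `y` the association
is used with `ε ∼ y ^ a` for a sufficiently large `a`. -/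
theorem mem_locSpace_zygmund {p q : ℝ≥0∞} [Fact (1 ≤ p)] [Fact (1 ≤ q)] (T : 𝓓'(Ω, ℂ))
    (f : GenFun p q Ω) (hTf : StronglyAssociated T f) (k : ℕ)
    (hf : ∀ s : ℝ, 0 < s → f ∈ GenFun.besovType ∞ k s) {s : ℝ} (hs : 0 < s) :
    T ∈ locSpace (zygmund d ((k : ℝ) - s)) Ω := by
  intro χ
  set r : ℝ := (k : ℝ) - s
  obtain ⟨S, hS⟩ := exists_tempered T χ
  refine ⟨S, ?_, hS⟩
  obtain ⟨u, hu, hassoc⟩ := hTf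
  obtain ⟨ω, hχω, hω⟩ := exists_compactlyIn χ.hasCompactSupport.isCompact χ.tsupport_subset
  obtain ⟨b, hb, hb'⟩ := hassoc ω hω
  obtain ⟨N, hN⟩ := exists_uniformlyAssociated hu.smoothNet hb' χ.hasCompactSupport.isCompact hχω
    χ.tsupport_subset
  intro φ ψ hφψ
  constructor
  · obtain ⟨N', C, hC0, hC⟩ := exists_norm_pair_le T χ.hasCompactSupport χ.tsupport_subset
    obtain ⟨D, hD0, hD⟩ := exists_mul_bound χ.contDiff χ.hasCompactSupport N'
    obtain ⟨B, hB0, hB⟩ := exists_kernel_bound φ N'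
    have hbd : ∀ x, ‖conv S φ x‖ ≤ C * (D * B) := by
      intro x
      rw [conv_apply_eq hS φ x (contDiff_kernel φ x)]
      refine hC _ (tsupport_mulSmooth_subset _ _ _) _ (by positivity)
        (hD _ (contDiff_kernel φ x) _ hB0 fun i hi z => ?_)
      simpa [dilate_one] using hB 1 (by simp) x i hi z
    rw [eLpNorm_exponent_top]
    exact (eLpNormEssSup_le_of_ae_bound (Filter.Eventually.of_forall hbd)).trans_lt
      ENNReal.ofReal_lt_top
  · set m := (⌊r⌋ + 1).toNat
    have hmk : m ≤ k := by
      have : ⌊r⌋ < (k : ℤ) := Int.floor_lt.2 (by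
        change (k : ℝ) - s < ((k : ℤ) : ℝ)
        push_cast
        linarith)
      omega
    have hmr : r < m := by
      have h1 : r < (⌊r⌋ : ℝ) + 1 := Int.lt_floor_add_one r
      have h2 : (⌊r⌋ + 1 : ℤ) ≤ (m : ℤ) := Int.self_le_toNat _
      have h3 : ((⌊r⌋ + 1 : ℤ) : ℝ) ≤ ((m : ℤ) : ℝ) := by exact_mod_cast h2
      push_cast at h3
      linarith
    -- The choice of `a` makes the error `ε ^ b y ^ (-(d + N))` at most `y ^ r`, and the choice of
    -- `t` makes the main term `ε ^ (-t) y ^ m` at most `y ^ r`, where `ε ∼ y ^ a`.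
    set a : ℝ := (|r| + d + N + 1) / b
    have ha : 0 < a := by positivity
    set t : ℝ := (m - r) / a
    have ht : 0 < t := div_pos (by linarith) ha
    obtain ⟨v, hv, hvg⟩ := hf t ht
    obtain ⟨C, hC0, hC⟩ := hN.exists_norm_pair_le hu.smoothNet hω hχω hv.smoothNet
      (hu.sub_mem hv) (hvg ω hω)
    obtain ⟨D, hD0, hD⟩ := exists_mul_bound χ.contDiff χ.hasCompactSupport N
    obtain ⟨B, hB0, hB⟩ := exists_kernel_bound ψ N
    obtain ⟨H, hH0, hH⟩ := exists_smoothing_bound χ hχω ψ hφψ.vanishingMoments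
    set c₁ : ℝ := D * B * (4⁻¹ : ℝ) ^ b
    set c₂ : ℝ := H * (4⁻¹ : ℝ) ^ (-t)
    have hmain : ∀ y ∈ Ioo (0 : ℝ) 1, ∀ x,
        y ^ (-r) * ‖conv S (dilate ψ y) x‖ ≤ C * (c₁ + c₂) := by
      intro y hy x
      have hy0 := hy.1
      have hyle : ∀ e : ℝ, 0 ≤ e → y ^ e ≤ 1 := fun e he =>
        Real.rpow_le_one hy0.le hy.2.le he
      have hδ : 4⁻¹ * y ^ a ∈ Ioo (0 : ℝ) (1 / 2) :=
        ⟨by positivity, by linarith [hyle a ha.le]⟩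
      have h := hC (mulSmooth χ _ (contDiff_kernel (dilate ψ y) x))
        (tsupport_mulSmooth_subset _ _ _) (D * (B * y ^ (-((d : ℝ) + N)))) (by positivity)
        (hD _ (contDiff_kernel _ x) _ (by positivity) (hB y ⟨hy0, hy.2.le⟩ x))
        (H * y ^ m) (by positivity) _ hδ (fun ε hε =>
          (hH (v ε) ((hv.smoothNet.1 ε (mem_Ioo_of_mem_Icc hδ hε)).mono hω.le) y hy0 x).trans
            (by gcongr; exact sobolevNorm_mono_order hmk _ _ _))
      rw [conv_apply_eq hS (dilate ψ y) x (contDiff_kernel _ x)]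
      have e1 : y ^ (-r) * (D * (B * y ^ (-((d : ℝ) + N))) * (4⁻¹ * y ^ a) ^ b) ≤ c₁ := by
        have hab : a * b = |r| + d + N + 1 := div_mul_cancel₀ _ hb.ne'
        rw [Real.mul_rpow (by norm_num) (by positivity), ← Real.rpow_mul hy0.le, hab]
        have : y ^ (-r) * (D * (B * y ^ (-((d : ℝ) + N))) *
            ((4⁻¹ : ℝ) ^ b * y ^ (|r| + d + N + 1))) =
            c₁ * (y ^ (-r) * y ^ (-((d : ℝ) + N)) * y ^ (|r| + d + N + 1)) := by
          simp only [c₁]; ring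
        rw [this, ← Real.rpow_add hy0, ← Real.rpow_add hy0]
        exact mul_le_of_le_one_right (by positivity) (hyle _ (by linarith [le_abs_self r]))
      have e2 : y ^ (-r) * (H * y ^ m * (4⁻¹ * y ^ a) ^ (-t)) = c₂ := by
        have hat : a * -t = r - m := by
          rw [mul_neg, mul_div_cancel₀ _ ha.ne']; ring
        rw [Real.mul_rpow (by norm_num) (by positivity), ← Real.rpow_mul hy0.le, hat,
          ← Real.rpow_natCast y m]
        have : y ^ (-r) * (H * y ^ (m : ℝ) * ((4⁻¹ : ℝ) ^ (-t) * y ^ (r - m))) =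
            c₂ * (y ^ (-r) * y ^ (m : ℝ) * y ^ (r - m)) := by
          simp only [c₂]; ring
        rw [this, ← Real.rpow_add hy0, ← Real.rpow_add hy0]
        simp
      calc y ^ (-r) * ‖pair T (mulSmooth χ _ (contDiff_kernel (dilate ψ y) x))‖
          ≤ y ^ (-r) * (C * (D * (B * y ^ (-((d : ℝ) + N))) * (4⁻¹ * y ^ a) ^ b +
              H * y ^ m * (4⁻¹ * y ^ a) ^ (-t))) := by gcongr
        _ = C * (y ^ (-r) * (D * (B * y ^ (-((d : ℝ) + N))) * (4⁻¹ * y ^ a) ^ b) +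
              y ^ (-r) * (H * y ^ m * (4⁻¹ * y ^ a) ^ (-t))) := by ring
        _ ≤ C * (c₁ + c₂) := by rw [e2]; gcongr
    have hc : 0 ≤ C * (c₁ + c₂) := by positivity
    unfold LqFinite
    rw [if_pos rfl]
    refine ⟨⟨C * (c₁ + c₂), hc⟩, fun y hy => ?_⟩
    have hyr : 0 < y ^ (-r) := Real.rpow_pos_of_pos hy.1 _
    have h1 : eLpNorm (conv S (dilate ψ y)) ∞ volume ≤
        ENNReal.ofReal ((y ^ (-r))⁻¹ * (C * (c₁ + c₂))) := by
      rw [eLpNorm_exponent_top]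
      refine eLpNormEssSup_le_of_ae_bound (Filter.Eventually.of_forall fun x => ?_)
      rw [le_inv_mul_iff₀ hyr]
      exact hmain y hy x
    calc ENNReal.ofReal (y ^ (-r)) * eLpNorm (conv S (dilate ψ y)) ∞ volume
        ≤ ENNReal.ofReal (y ^ (-r)) * ENNReal.ofReal ((y ^ (-r))⁻¹ * (C * (c₁ + c₂))) := by gcongr
      _ = ENNReal.ofReal (C * (c₁ + c₂)) := by
          rw [← ENNReal.ofReal_mul hyr.le, mul_inv_cancel_left₀ hyr.ne']
      _ = _ := ENNReal.ofReal_eq_coe_nnreal hc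

end ZygmundRegularity

/-! ### Decay of Fourier transforms -/

section FourierDecay

variable {d : ℕ} {Ω : Opens (E d)}

/-- The plane wave `x ↦ exp (-2πi ⟨x, ξ⟩)`, the kernel of the Fourier transform. -/
noncomputable def wave (ξ x : E d) : ℂ := (Real.fourierChar (-inner ℝ x ξ) : ℂ)

theorem continuous_wave : Continuous fun z : E d × E d => wave z.1 z.2 := by
  unfold wave
  fun_prop

theorem iteratedDeriv_fourierChar (n : ℕ) :
    iteratedDeriv n (fun t : ℝ => (Real.fourierChar t : ℂ)) =
      fun t => (2 * Real.pi * Complex.I) ^ n * (Real.fourierChar t : ℂ) := by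
  induction n with
  | zero => simp
  | succ n ih =>
    funext t
    rw [iteratedDeriv_succ, ih]
    exact ((Real.hasDerivAt_fourierChar t).const_mul _).deriv.trans (by ring)

theorem contDiff_fourierChar : ContDiff ℝ (⊤ : ℕ∞) fun t : ℝ => (Real.fourierChar t : ℂ) := by
  simp only [Real.fourierChar_apply]
  exact ((Complex.ofRealCLM.contDiff.comp
    (contDiff_const.mul contDiff_id : ContDiff ℝ _ fun t : ℝ => 2 * Real.pi * t)).mul
      contDiff_const).cexp

theorem wave_eq_comp (ξ : E d) :
    wave ξ = (fun t : ℝ => (Real.fourierChar t : ℂ)) ∘ (-innerSL ℝ ξ) := by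
  funext x
  simp [wave, real_inner_comm]

theorem contDiff_wave (ξ : E d) : ContDiff ℝ (⊤ : ℕ∞) (wave ξ) := by
  rw [wave_eq_comp]
  exact contDiff_fourierChar.comp (ContinuousLinearMap.contDiff _)

theorem norm_iteratedFDeriv_wave_le {N i : ℕ} (hi : i ≤ N) (ξ x : E d) :
    ‖iteratedFDeriv ℝ i (wave ξ) x‖ ≤ (2 * Real.pi) ^ N * (1 + ‖ξ‖) ^ N := by
  have hi' : ((i : ℕ∞) : WithTop ℕ∞) ≤ ((⊤ : ℕ∞) : WithTop ℕ∞) := by exact_mod_cast le_top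
  have hpi : 1 ≤ 2 * Real.pi := by linarith [Real.two_le_pi]
  rw [wave_eq_comp, ContinuousLinearMap.iteratedFDeriv_comp_right _ contDiff_fourierChar x hi']
  refine (ContinuousMultilinearMap.norm_compContinuousLinearMap_le _ _).trans ?_
  rw [norm_iteratedFDeriv_eq_norm_iteratedDeriv, iteratedDeriv_fourierChar, Finset.prod_const,
    Finset.card_univ, Fintype.card_fin, norm_neg, innerSL_apply_norm, norm_mul, Circle.norm_coe,
    mul_one, norm_pow]
  have h1 : ‖(2 * Real.pi * Complex.I : ℂ)‖ = 2 * Real.pi := by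
    simp [abs_of_pos Real.pi_pos]
  rw [h1]
  have hξ := norm_nonneg ξ
  calc (2 * Real.pi) ^ i * ‖ξ‖ ^ i ≤ (2 * Real.pi) ^ i * (1 + ‖ξ‖) ^ i := by
        gcongr; linarith
    _ ≤ _ := by
        gcongr
        linarith

theorem fourier_eq_integral_wave (g : E d → ℂ) (ξ : E d) :
    𝓕 g ξ = ∫ x, wave ξ x * g x := by
  rw [Real.fourier_eq]
  rfl

/-- Integrating by parts `k` times gains `k` powers of the frequency. -/
theorem exists_fourier_decay (χ : 𝓓(Ω, ℂ)) {ω : Opens (E d)} (hs : tsupport χ ⊆ ω) (k : ℕ) :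
    ∃ H : ℝ, 0 ≤ H ∧ ∀ g : E d → ℂ, ContDiffOn ℝ (⊤ : ℕ∞) g ω → ∀ ξ : E d,
      ‖∫ x, g x * mulSmooth χ (wave ξ) (contDiff_wave ξ) x‖ₑ ≤
        ENNReal.ofReal (H * ((1 + ‖ξ‖) ^ k)⁻¹) * sobolevNorm k 1 ω g := by
  choose C hC using fun j => exists_lintegral_bound χ.contDiff χ.hasCompactSupport hs j
  set A : ℝ := ∑ j ∈ Finset.range (k + 1), (C j : ℝ)
  have hA0 : 0 ≤ A := by positivity
  -- Adding `1` keeps the bound meaningful when the Sobolev norm is infinite.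
  refine ⟨2 ^ k * (A + 2 ^ k * A) + 1, by positivity, fun g hg ξ => ?_⟩
  rcases eq_or_ne (sobolevNorm k 1 ω g) ∞ with htop | htop
  · rw [htop, ENNReal.mul_top]
    · exact le_top
    · rw [Ne, ENNReal.ofReal_eq_zero, not_le]
      positivity
  set h : E d → ℂ := fun x => χ x * g x
  set W := (sobolevNorm k 1 ω g).toReal
  have hh : ContDiff ℝ (⊤ : ℕ∞) h := contDiff_mul_of_tsupport_subset χ.contDiff hs hg
  have hhc : HasCompactSupport h := χ.hasCompactSupport.mul_right
  have hint : ∀ j, Integrable fun x => iteratedFDeriv ℝ j h x := fun j =>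
    (hh.continuous_iteratedFDeriv (by exact_mod_cast le_top)).integrable_of_hasCompactSupport
      (hhc.iteratedFDeriv j)
  have hj : ∀ j ≤ k, ∫ x, ‖iteratedFDeriv ℝ j h x‖ ≤ C j * W := by
    intro j hjk
    rw [integral_norm_eq_lintegral_enorm (hint j).aestronglyMeasurable]
    have h1 : ∫⁻ x, ‖iteratedFDeriv ℝ j h x‖ₑ ≤ C j * sobolevNorm k 1 ω g :=
      (hC j g hg).trans (by gcongr; exact sobolevNorm_mono_order hjk _ _ _)
    have h2 := ENNReal.toReal_mono (ENNReal.mul_ne_top ENNReal.coe_ne_top htop) h1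
    rwa [ENNReal.toReal_mul, ENNReal.coe_toReal] at h2
  have hF : ∀ n ≤ k, ‖ξ‖ ^ n * ‖𝓕 h ξ‖ ≤ 2 ^ n * (A * W) := by
    intro n hn
    have h1 := Real.pow_mul_norm_iteratedFDeriv_fourier_le (f := h) (K := 0) (N := ⊤) hh
      (fun i n hi _ => by
        have : i = 0 := by simpa using hi
        subst this
        simpa using (hint n).norm) (k := 0) (n := n) le_rfl le_top ξ
    simp only [norm_iteratedFDeriv_zero, pow_zero, one_mul, CharP.cast_eq_zero, mul_zero,
      zero_add] at h1
    refine h1.trans ?_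
    gcongr
    rw [Finset.range_one, Finset.singleton_product, Finset.sum_map]
    simp only [Function.Embedding.coeFn_mk, pow_zero, one_mul]
    calc ∑ j ∈ Finset.range (n + 1), ∫ x, ‖iteratedFDeriv ℝ j h x‖
        ≤ ∑ j ∈ Finset.range (n + 1), C j * W := Finset.sum_le_sum fun j hj' =>
          hj j ((Nat.lt_succ_iff.1 (Finset.mem_range.1 hj')).trans hn)
      _ ≤ ∑ j ∈ Finset.range (k + 1), C j * W :=
          Finset.sum_le_sum_of_subset_of_nonneg
            (Finset.range_mono (by omega)) fun _ _ _ => by positivity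
      _ = A * W := by rw [Finset.sum_mul]
  have heq : ∫ x, g x * mulSmooth χ (wave ξ) (contDiff_wave ξ) x = 𝓕 h ξ := by
    rw [fourier_eq_integral_wave]
    refine integral_congr_ae (Filter.Eventually.of_forall fun x => ?_)
    simp only [mulSmooth_apply, h]
    ring
  have hξ := norm_nonneg ξ
  have hpow : (1 + ‖ξ‖) ^ k ≤ 2 ^ k * (1 + ‖ξ‖ ^ k) := by
    rcases le_total ‖ξ‖ 1 with h1 | h1
    · calc (1 + ‖ξ‖) ^ k ≤ 2 ^ k := by gcongr; linarith
        _ ≤ _ := le_mul_of_one_le_right (by positivity) (by linarith [pow_nonneg hξ k])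
    · calc (1 + ‖ξ‖) ^ k ≤ (2 * ‖ξ‖) ^ k := by gcongr; linarith
        _ = 2 ^ k * ‖ξ‖ ^ k := mul_pow _ _ _
        _ ≤ _ := by gcongr; linarith
  rw [heq, ← ofReal_norm, ← ENNReal.ofReal_toReal htop, ← ENNReal.ofReal_mul (by positivity)]
  refine ENNReal.ofReal_le_ofReal ?_
  rw [mul_right_comm, ← div_eq_mul_inv, le_div_iff₀ (by positivity)]
  have h0 := hF 0 (Nat.zero_le _)
  have hk := hF k le_rfl
  rw [pow_zero, pow_zero, one_mul, one_mul] at h0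
  have hW : 0 ≤ W := ENNReal.toReal_nonneg
  calc ‖𝓕 h ξ‖ * (1 + ‖ξ‖) ^ k ≤ ‖𝓕 h ξ‖ * (2 ^ k * (1 + ‖ξ‖ ^ k)) := by gcongr
    _ = 2 ^ k * (‖𝓕 h ξ‖ + ‖ξ‖ ^ k * ‖𝓕 h ξ‖) := by ring
    _ ≤ 2 ^ k * (A * W + 2 ^ k * (A * W)) := by gcongr
    _ = 2 ^ k * (A + 2 ^ k * A) * W := by ring
    _ ≤ _ := by gcongr; linarith

/-- The Fourier transform `ξ ↦ ⟨T, χ exp (-2πi ⟨·, ξ⟩)⟩` of the localization `χ T`. -/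
noncomputable def localFourier (T : 𝓓'(Ω, ℂ)) (χ : 𝓓(Ω, ℂ)) (ξ : E d) : ℂ :=
  pair T (mulSmooth χ (wave ξ) (contDiff_wave ξ))

theorem exists_wave_bound (χ : 𝓓(Ω, ℂ)) (N : ℕ) :
    ∃ D : ℝ, 0 ≤ D ∧ ∀ ξ : E d, ∀ i ≤ N, ∀ x,
      ‖iteratedFDeriv ℝ i (mulSmooth χ (wave ξ) (contDiff_wave ξ)) x‖ ≤ D * (1 + ‖ξ‖) ^ N := by
  obtain ⟨D, hD0, hD⟩ := exists_mul_bound χ.contDiff χ.hasCompactSupport N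
  refine ⟨D * (2 * Real.pi) ^ N, by positivity, fun ξ i hi x => ?_⟩
  rw [mul_assoc]
  exact hD _ (contDiff_wave ξ) _ (by positivity)
    (fun i hi x => norm_iteratedFDeriv_wave_le hi ξ x) i hi x

/-- If all derivatives of a strongly associated generalized function have the same growth exponent,
the localizations of the limit have rapidly decreasing Fourier transforms: at frequency `ξ` the
association is used with `ε ∼ (1 + |ξ|) ^ (-a)`. -/
theorem exists_localFourier_decay {p q : ℝ≥0∞} [Fact (1 ≤ p)] [Fact (1 ≤ q)] {T : 𝓓'(Ω, ℂ)}
    {f : GenFun p q Ω} {u : ℝ → E d → ℂ} (hu : f.IsRep u) {χ : 𝓓(Ω, ℂ)} {b : ℝ} (hb : 0 < b)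
    {N : ℕ} (hN : UniformlyAssociated T u (tsupport χ) b N) {ω : Opens (E d)} (hω : ω ≤ Ω)
    (hχ : tsupport χ ⊆ ω) {s : ℝ}
    (hs : ∀ k : ℕ, GenFun.restrict hω f ∈ GenFun.besovType (p := p) (q := q) (Ω := ω) p k s)
    (l : ℕ) :
    ∃ C : ℝ, 0 ≤ C ∧ ∀ ξ : E d, ‖localFourier T χ ξ‖ ≤ C * (1 + ‖ξ‖) ^ (-(l : ℝ)) := by
  obtain ⟨ω₂, hχω₂, hω₂⟩ := exists_compactlyIn χ.hasCompactSupport.isCompact hχ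
  set a : ℝ := (N + l) / b
  have ha : 0 ≤ a := by positivity
  obtain ⟨k, hk⟩ := exists_nat_ge (a * s + l)
  obtain ⟨v, hv, hvg⟩ := hs k
  obtain ⟨C, hC0, hC⟩ := hN.exists_norm_pair_le hu.smoothNet hω₂ hχω₂ hv.smoothNet
    ((hu.restrict hω).sub_mem hv)
    ((hvg ω₂ hω₂).one Fact.out (hv.smoothNet.mono hω₂.le) hω₂.1)
  obtain ⟨D, hD0, hD⟩ := exists_wave_bound χ N
  obtain ⟨H, hH0, hH⟩ := exists_fourier_decay χ hχω₂ k
  refine ⟨C * (D * 4⁻¹ ^ b + H * 4⁻¹ ^ (-s)), by positivity, fun ξ => ?_⟩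
  set t : ℝ := 1 + ‖ξ‖
  have ht1 : 1 ≤ t := by simp [t]
  have ht0 : 0 < t := by linarith
  have hta : t ^ (-a) ≤ 1 := Real.rpow_le_one_of_one_le_of_nonpos ht1 (by linarith)
  have hδ : 4⁻¹ * t ^ (-a) ∈ Ioo (0 : ℝ) (1 / 2) := ⟨by positivity, by linarith⟩
  have h := hC (mulSmooth χ (wave ξ) (contDiff_wave ξ)) (tsupport_mulSmooth_subset _ _ _)
    (D * t ^ N) (by positivity) (hD ξ) (H * (t ^ k)⁻¹) (by positivity) _ hδ fun ε hε =>
      hH (v ε) ((hv.smoothNet.1 ε (mem_Ioo_of_mem_Icc hδ hε)).mono hω₂.le) ξ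
  have e1 : D * t ^ N * (4⁻¹ * t ^ (-a)) ^ b = D * 4⁻¹ ^ b * t ^ (-(l : ℝ)) := by
    have hab : -a * b = -((N : ℝ) + l) := by
      rw [neg_mul, div_mul_cancel₀ _ hb.ne']
    rw [Real.mul_rpow (by norm_num) (by positivity), ← Real.rpow_mul ht0.le, hab,
      ← Real.rpow_natCast t N]
    have : t ^ (-(l : ℝ)) = t ^ (N : ℝ) * t ^ (-((N : ℝ) + l)) := by
      rw [← Real.rpow_add ht0]; congr 1; ring
    rw [this]
    ring
  have e2 : H * (t ^ k)⁻¹ * (4⁻¹ * t ^ (-a)) ^ (-s) ≤ H * 4⁻¹ ^ (-s) * t ^ (-(l : ℝ)) := by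
    rw [Real.mul_rpow (by norm_num) (by positivity), ← Real.rpow_mul ht0.le,
      ← Real.rpow_natCast t k, ← Real.rpow_neg ht0.le]
    have : t ^ (-(k : ℝ)) * t ^ (-a * -s) ≤ t ^ (-(l : ℝ)) := by
      rw [← Real.rpow_add ht0]
      exact Real.rpow_le_rpow_of_exponent_le ht1 (by linarith)
    calc _ = H * 4⁻¹ ^ (-s) * (t ^ (-(k : ℝ)) * t ^ (-a * -s)) := by ring
      _ ≤ _ := by gcongr
  calc ‖localFourier T χ ξ‖ ≤ C * (D * t ^ N * (4⁻¹ * t ^ (-a)) ^ b +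
        H * (t ^ k)⁻¹ * (4⁻¹ * t ^ (-a)) ^ (-s)) := h
    _ ≤ C * (D * 4⁻¹ ^ b * t ^ (-(l : ℝ)) + H * 4⁻¹ ^ (-s) * t ^ (-(l : ℝ))) := by
        rw [e1]; gcongr
    _ = _ := by ring

end FourierDecay

/-! ### Fourier inversion for localized distributions -/

section Inversion

open Filter
open scoped Topology

variable {d : ℕ} {Ω : Opens (E d)}

theorem UniformlyAssociated.exists_wave_defect_bound {T : 𝓓'(Ω, ℂ)} {u : ℝ → E d → ℂ}
    {χ : 𝓓(Ω, ℂ)} {b : ℝ} {N : ℕ} (hN : UniformlyAssociated T u (tsupport χ) b N) :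
    ∃ C : ℝ, 0 ≤ C ∧ ∀ ξ : E d, ∀ δ ∈ Ioo (0 : ℝ) (1 / 2),
      ∫⁻ ε in Icc δ (2 * δ), ‖defect T u ε (mulSmooth χ (wave ξ) (contDiff_wave ξ))‖ₑ ≤
        ENNReal.ofReal (C * (1 + ‖ξ‖) ^ N * δ ^ (b + 1)) := by
  obtain ⟨C, hC0, hC⟩ := hN
  obtain ⟨D, hD0, hD⟩ := exists_wave_bound χ N
  refine ⟨C * D, by positivity, fun ξ δ hδ => ?_⟩
  have := hC _ (tsupport_mulSmooth_subset χ _ (contDiff_wave ξ)) _ (by positivity) (hD ξ) δ hδ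
  rwa [← mul_assoc] at this

/-- The Fourier transforms of `χ u_ε` depend continuously on `ε` and on the frequency. -/
theorem SmoothNet.continuousOn_integral_wave {u : ℝ → E d → ℂ} (hu : SmoothNet Ω u)
    (χ : 𝓓(Ω, ℂ)) :
    ContinuousOn (fun z : ℝ × E d => ∫ x, u z.1 x *
      mulSmooth χ (wave z.2) (contDiff_wave z.2) x) (Ioo (0 : ℝ) 1 ×ˢ univ) := by
  refine hu.continuousOn_integral_mul (G := fun ξ => mulSmooth χ (wave ξ) (contDiff_wave ξ))
    χ.hasCompactSupport χ.tsupport_subset ?_ fun ξ x hx => ?_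
  · exact (χ.continuous.comp continuous_snd).mul continuous_wave
  · rw [mulSmooth_apply, image_eq_zero_of_notMem_tsupport hx, zero_mul]

theorem aestronglyMeasurable_integral_wave {u : ℝ → E d → ℂ} (hu : SmoothNet Ω u)
    (χ : 𝓓(Ω, ℂ)) {δ : ℝ} (hδ : δ ∈ Ioo (0 : ℝ) (1 / 2)) :
    AEStronglyMeasurable (fun z : ℝ × E d => ∫ x, u z.1 x *
      mulSmooth χ (wave z.2) (contDiff_wave z.2) x)
      ((volume.restrict (Icc δ (2 * δ))).prod (volume : Measure (E d))) := by
  have h : (volume.restrict (Icc δ (2 * δ))).prod (volume : Measure (E d)) =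
      ((volume : Measure ℝ).prod (volume : Measure (E d))).restrict (Icc δ (2 * δ) ×ˢ univ) := by
    rw [← Measure.prod_restrict, Measure.restrict_univ]
  rw [h]
  refine ContinuousOn.aestronglyMeasurable ?_ (measurableSet_Icc.prod MeasurableSet.univ)
  exact (hu.continuousOn_integral_wave χ).mono
    (prod_mono (fun ε hε => mem_Ioo_of_mem_Icc hδ hε) le_rfl)

/-- Measurability of the Fourier transform of `χ T`, which is a pointwise limit of averages of the
Fourier transforms of `χ u_ε`. -/
theorem aestronglyMeasurable_localFourier {T : 𝓓'(Ω, ℂ)} {u : ℝ → E d → ℂ} (hu : SmoothNet Ω u)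
    {χ : 𝓓(Ω, ℂ)} {b : ℝ} (hb : 0 < b) {N : ℕ}
    (hN : UniformlyAssociated T u (tsupport χ) b N) :
    AEStronglyMeasurable (localFourier T χ) (volume : Measure (E d)) := by
  obtain ⟨C, hC0, hC⟩ := hN.exists_wave_defect_bound
  -- The shift by `3` keeps `δ n` inside `(0, 1 / 2)`.
  set δ : ℕ → ℝ := fun n => 1 / ((n : ℝ) + 3)
  have hδ : ∀ n, δ n ∈ Ioo (0 : ℝ) (1 / 2) := fun n => by
    refine ⟨by positivity, ?_⟩
    have : (0 : ℝ) ≤ n := Nat.cast_nonneg n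
    exact one_div_lt_one_div_of_lt (by norm_num) (by linarith)
  have hδ0 : Tendsto δ atTop (𝓝 0) := by
    have h1 : Tendsto (fun n : ℕ => (n : ℝ) + 3) atTop atTop :=
      tendsto_atTop_add_const_right _ _ tendsto_natCast_atTop_atTop
    exact h1.inv_tendsto_atTop.congr fun n => by simp [δ]
  set F : ℝ → E d → ℂ := fun ε ξ => ∫ x, u ε x * mulSmooth χ (wave ξ) (contDiff_wave ξ) x
  refine aestronglyMeasurable_of_tendsto_ae (u := atTop)
    (f := fun n ξ => (δ n)⁻¹ • ∫ ε in Icc (δ n) (2 * δ n), F ε ξ) (fun n => ?_)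
    (Eventually.of_forall fun ξ => ?_)
  · have h := (aestronglyMeasurable_integral_wave hu χ (hδ n)).prod_swap.integral_prod_right'
    exact h.const_smul (δ n)⁻¹
  · rw [tendsto_iff_norm_sub_tendsto_zero]
    have hlim : Tendsto (fun n => C * (1 + ‖ξ‖) ^ N * δ n ^ b) atTop (𝓝 0) := by
      have : Tendsto (fun n => δ n ^ b) atTop (𝓝 0) := by
        simpa [Real.zero_rpow hb.ne'] using hδ0.rpow_const (p := b) (Or.inr hb.le)
      simpa using this.const_mul (C * (1 + ‖ξ‖) ^ N)
    refine squeeze_zero (fun n => norm_nonneg _) (fun n => ?_) hlim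
    have hn := (hδ n).1
    have hcont : ContinuousOn (fun ε => F ε ξ) (Icc (δ n) (2 * δ n)) :=
      (hu.continuousOn_integral_wave χ).comp (f := fun ε : ℝ => (ε, ξ)) (by fun_prop)
        fun ε hε => ⟨mem_Ioo_of_mem_Icc (hδ n) hε, mem_univ _⟩
    have hconst : (δ n)⁻¹ • ∫ _ε in Icc (δ n) (2 * δ n), localFourier T χ ξ =
        localFourier T χ ξ := by
      rw [setIntegral_const, Real.volume_real_Icc_of_le (by linarith), smul_smul]
      have : (δ n)⁻¹ * (2 * δ n - δ n) = 1 := by field_simp; ring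
      rw [this, one_smul]
    have hint : IntegrableOn (fun _ : ℝ => localFourier T χ ξ) (Icc (δ n) (2 * δ n)) volume :=
      integrableOn_const (by simp)
    rw [← hconst, ← smul_sub, ← integral_sub hcont.integrableOn_Icc hint, norm_smul, norm_inv,
      Real.norm_of_nonneg hn.le, inv_mul_le_iff₀ hn]
    have h1 : ‖∫ ε in Icc (δ n) (2 * δ n), (F ε ξ - localFourier T χ ξ)‖ₑ ≤
        ENNReal.ofReal (C * (1 + ‖ξ‖) ^ N * δ n ^ (b + 1)) := by
      refine (enorm_integral_le_lintegral_enorm _).trans ((lintegral_mono fun ε => ?_).trans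
        (hC ξ (δ n) (hδ n)))
      rw [← enorm_neg, neg_sub]
      rfl
    rw [← ofReal_norm, ENNReal.ofReal_le_ofReal_iff (by positivity)] at h1
    refine h1.trans (le_of_eq ?_)
    rw [Real.rpow_add_one hn.ne']
    ring

/-- For smooth functions, Fourier inversion is Parseval's identity for Schwartz functions. -/
theorem integral_mul_mulTest_eq {g : E d → ℂ} (hg : ContDiffOn ℝ (⊤ : ℕ∞) g Ω) (χ : 𝓓(Ω, ℂ))
    (ρ : 𝓢(E d, ℂ)) :
    (Integrable fun ξ => (∫ x, g x * mulSmooth χ (wave ξ) (contDiff_wave ξ) x) * 𝓕⁻ ρ ξ) ∧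
    ∫ x, g x * mulTest χ ρ x =
      ∫ ξ, (∫ x, g x * mulSmooth χ (wave ξ) (contDiff_wave ξ) x) * 𝓕⁻ ρ ξ := by
  have hs := contDiff_mul_of_tsupport_subset χ.contDiff χ.tsupport_subset hg
  have hc : HasCompactSupport fun x => χ x * g x := χ.hasCompactSupport.mul_right
  set h : 𝓢(E d, ℂ) := hc.toSchwartzMap hs
  have hF : ∀ ξ, ∫ x, g x * mulSmooth χ (wave ξ) (contDiff_wave ξ) x = 𝓕 h ξ := by
    intro ξ
    rw [SchwartzMap.fourier_coe, fourier_eq_integral_wave]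
    refine integral_congr_ae (Eventually.of_forall fun x => ?_)
    change g x * (χ x * wave ξ x) = wave ξ x * (χ x * g x)
    ring
  simp only [hF]
  refine ⟨?_, ?_⟩
  · obtain ⟨B, hB⟩ : ∃ B, ∀ ξ, ‖𝓕 h ξ‖ ≤ B :=
      ⟨SchwartzMap.seminorm ℝ 0 0 (𝓕 h), fun ξ => by
        simpa using SchwartzMap.norm_iteratedFDeriv_le_seminorm ℝ (𝓕 h) 0 ξ⟩
    exact (𝓕⁻ ρ).integrable.bdd_mul (𝓕 h).continuous.aestronglyMeasurable
      (Eventually.of_forall hB)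
  · rw [SchwartzMap.integral_fourier_mul_eq, FourierTransform.fourier_fourierInv_eq]
    refine integral_congr_ae (Eventually.of_forall fun x => ?_)
    change g x * (χ x * ρ x) = χ x * g x * ρ x
    ring

/-- **Fourier inversion** for the localization `χ T`: it holds for `χ u_ε` and passes to the limit,
because the errors are polynomially bounded in the frequency. -/
theorem pair_mulTest_eq_integral {T : 𝓓'(Ω, ℂ)} {u : ℝ → E d → ℂ} (hu : SmoothNet Ω u)
    {χ : 𝓓(Ω, ℂ)} {b : ℝ} (hb : 0 < b) {N : ℕ}
    (hN : UniformlyAssociated T u (tsupport χ) b N) {A : ℝ}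
    (hA : ∀ ξ, ‖localFourier T χ ξ‖ ≤ A) (ρ : 𝓢(E d, ℂ)) :
    pair T (mulTest χ ρ) = ∫ ξ, localFourier T χ ξ * 𝓕⁻ ρ ξ := by
  have hFm := aestronglyMeasurable_localFourier hu hb hN
  obtain ⟨C, hC0, hC⟩ := hN.exists_wave_defect_bound
  obtain ⟨C', hC'0, hC'⟩ := hN
  obtain ⟨D, hD0, hD⟩ := exists_mul_bound χ.contDiff χ.hasCompactSupport N
  set M := ∑ i ∈ Finset.range (N + 1), SchwartzMap.seminorm ℝ 0 i ρ
  have hM : 0 ≤ M := by positivity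
  have hρ : ∀ i ≤ N, ∀ x, ‖iteratedFDeriv ℝ i (mulTest χ ρ) x‖ ≤ D * M := by
    refine hD ρ (ρ.smooth _) M hM fun i hi x => ?_
    exact (SchwartzMap.norm_iteratedFDeriv_le_seminorm ℝ ρ i x).trans
      (Finset.single_le_sum (f := fun i => SchwartzMap.seminorm ℝ 0 i ρ)
        (fun i _ => apply_nonneg _ _) (Finset.mem_range.2 (Nat.lt_succ_of_le hi)))
  have hint : Integrable fun ξ => localFourier T χ ξ * 𝓕⁻ ρ ξ :=
    (𝓕⁻ ρ).integrable.bdd_mul hFm (Eventually.of_forall hA)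
  set J : ℝ≥0∞ := ∫⁻ ξ, ENNReal.ofReal (C * (1 + ‖ξ‖) ^ N) * ‖𝓕⁻ ρ ξ‖ₑ
  have hJ : J ≠ ∞ := by
    have hpoly : Integrable fun ξ : E d => (1 + ‖ξ‖) ^ N * ‖𝓕⁻ ρ ξ‖ := by
      have hle : ∀ ξ : E d, (1 + ‖ξ‖) ^ N ≤ 2 ^ N * (1 + ‖ξ‖ ^ N) := fun ξ => by
        have := add_pow_le zero_le_one (norm_nonneg ξ) N
        refine this.trans ?_
        rw [one_pow]
        gcongr
        · norm_num
        · omega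
      refine (((𝓕⁻ ρ).integrable.norm.add
        ((𝓕⁻ ρ).integrable_pow_mul volume N)).const_mul (2 ^ N)).mono' ?_
        (Eventually.of_forall fun ξ => ?_)
      · exact (Continuous.mul (by fun_prop)
          (𝓕⁻ ρ).continuous.norm).aestronglyMeasurable
      · rw [Real.norm_of_nonneg (by positivity)]
        calc (1 + ‖ξ‖) ^ N * ‖𝓕⁻ ρ ξ‖ ≤ 2 ^ N * (1 + ‖ξ‖ ^ N) * ‖𝓕⁻ ρ ξ‖ := by
              gcongr; exact hle ξ
          _ = 2 ^ N * (‖𝓕⁻ ρ ξ‖ + ‖ξ‖ ^ N * ‖𝓕⁻ ρ ξ‖) := by ring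
    have h2 : J = ∫⁻ ξ, ‖C * ((1 + ‖ξ‖) ^ N * ‖𝓕⁻ ρ ξ‖)‖ₑ := by
      refine lintegral_congr fun ξ => ?_
      rw [← mul_assoc, enorm_mul, enorm_norm, Real.enorm_of_nonneg (by positivity)]
    rw [h2]
    exact (hpoly.const_mul C).2.ne
  set X : ℂ := pair T (mulTest χ ρ) - ∫ ξ, localFourier T χ ξ * 𝓕⁻ ρ ξ
  have hX : ∀ δ ∈ Ioo (0 : ℝ) (1 / 2), ‖X‖ ≤ (C' * (D * M) + J.toReal) * δ ^ b := by
    intro δ hδ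
    have hδ0 := hδ.1
    have hmem : ∀ ε ∈ Icc δ (2 * δ), ε ∈ Ioo (0 : ℝ) 1 := fun ε hε => mem_Ioo_of_mem_Icc hδ hε
    have hpt : ∀ ε ∈ Icc δ (2 * δ), ‖X‖ₑ ≤ ‖defect T u ε (mulTest χ ρ)‖ₑ +
        ∫⁻ ξ, ‖defect T u ε (mulSmooth χ (wave ξ) (contDiff_wave ξ))‖ₑ * ‖𝓕⁻ ρ ξ‖ₑ := by
      intro ε hε
      obtain ⟨hi, he⟩ := integral_mul_mulTest_eq (hu.1 ε (hmem ε hε)) χ ρ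
      have hXe : X = defect T u ε (mulTest χ ρ) -
          ∫ ξ, defect T u ε (mulSmooth χ (wave ξ) (contDiff_wave ξ)) * 𝓕⁻ ρ ξ := by
        have : ∫ ξ, defect T u ε (mulSmooth χ (wave ξ) (contDiff_wave ξ)) * 𝓕⁻ ρ ξ =
            (∫ ξ, localFourier T χ ξ * 𝓕⁻ ρ ξ) - ∫ x, u ε x * mulTest χ ρ x := by
          rw [he, ← integral_sub hint hi]
          refine integral_congr_ae (Eventually.of_forall fun ξ => ?_)
          simp only [defect, localFourier, sub_mul]
        rw [this, defect]
        ring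
      rw [hXe]
      refine (enorm_sub_le).trans ?_
      gcongr
      refine (enorm_integral_le_lintegral_enorm _).trans (le_of_eq ?_)
      simp only [enorm_mul]
    have hmeas : AEMeasurable (fun ε => ‖defect T u ε (mulTest χ ρ)‖ₑ)
        (volume.restrict (Icc δ (2 * δ))) :=
      (((hu.continuousOn_defect T (mulTest χ ρ)).mono hmem).aestronglyMeasurable
        measurableSet_Icc).enorm
    have hjoint : AEMeasurable (Function.uncurry fun ε ξ =>
        ‖defect T u ε (mulSmooth χ (wave ξ) (contDiff_wave ξ))‖ₑ * ‖𝓕⁻ ρ ξ‖ₑ)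
        ((volume.restrict (Icc δ (2 * δ))).prod (volume : Measure (E d))) := by
      have h1 := (hFm.comp_snd (μ := volume.restrict (Icc δ (2 * δ)))).sub
        (aestronglyMeasurable_integral_wave hu χ hδ)
      exact h1.enorm.mul
        ((𝓕⁻ ρ).continuous.comp continuous_snd).aestronglyMeasurable.enorm
    have hmain : ENNReal.ofReal (‖X‖ * δ) ≤
        ENNReal.ofReal ((C' * (D * M) + J.toReal) * δ ^ (b + 1)) := by
      calc ENNReal.ofReal (‖X‖ * δ) = ∫⁻ ε in Icc δ (2 * δ), ‖X‖ₑ := by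
            rw [setLIntegral_const, Real.volume_Icc, ENNReal.ofReal_mul (norm_nonneg _),
              ofReal_norm]
            congr 2; ring
        _ ≤ ∫⁻ ε in Icc δ (2 * δ), (‖defect T u ε (mulTest χ ρ)‖ₑ + ∫⁻ ξ,
              ‖defect T u ε (mulSmooth χ (wave ξ) (contDiff_wave ξ))‖ₑ * ‖𝓕⁻ ρ ξ‖ₑ) :=
            setLIntegral_mono' measurableSet_Icc hpt
        _ = (∫⁻ ε in Icc δ (2 * δ), ‖defect T u ε (mulTest χ ρ)‖ₑ) +
              ∫⁻ ξ, (∫⁻ ε in Icc δ (2 * δ),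
                ‖defect T u ε (mulSmooth χ (wave ξ) (contDiff_wave ξ))‖ₑ) * ‖𝓕⁻ ρ ξ‖ₑ := by
            rw [lintegral_add_left' hmeas, lintegral_lintegral_swap hjoint]
            congr 1
            refine lintegral_congr fun ξ => ?_
            rw [lintegral_mul_const' _ _ enorm_ne_top]
        _ ≤ ENNReal.ofReal (C' * (D * M) * δ ^ (b + 1)) +
              ∫⁻ ξ, ENNReal.ofReal (C * (1 + ‖ξ‖) ^ N * δ ^ (b + 1)) * ‖𝓕⁻ ρ ξ‖ₑ := by
            gcongr with ξ
            · exact hC' _ (tsupport_mulSmooth_subset χ ρ (ρ.smooth _)) _ (by positivity) hρ δ hδ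
            · exact hC ξ δ hδ
        _ = ENNReal.ofReal (C' * (D * M) * δ ^ (b + 1)) + ENNReal.ofReal (δ ^ (b + 1)) * J := by
            congr 1
            rw [← lintegral_const_mul' _ _ ENNReal.ofReal_ne_top]
            refine lintegral_congr fun ξ => ?_
            rw [mul_comm (C * _), ENNReal.ofReal_mul (by positivity), mul_assoc]
        _ = _ := by
            conv_lhs => rw [← ENNReal.ofReal_toReal hJ]
            rw [← ENNReal.ofReal_mul (by positivity), ← ENNReal.ofReal_add (by positivity)
              (by positivity)]
            congr 1; ring
    rw [ENNReal.ofReal_le_ofReal_iff (by positivity), Real.rpow_add_one hδ0.ne', ← mul_assoc]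
      at hmain
    exact le_of_mul_le_mul_right hmain hδ0
  have hlim : Tendsto (fun δ : ℝ => (C' * (D * M) + J.toReal) * δ ^ b) (𝓝[>] 0) (𝓝 0) := by
    have h1 : Tendsto (fun δ : ℝ => δ ^ b) (𝓝[>] 0) (𝓝 0) := by
      have : ContinuousAt (fun δ : ℝ => δ ^ b) 0 := Real.continuousAt_rpow_const _ _ (Or.inr hb.le)
      simpa [Real.zero_rpow hb.ne'] using this.tendsto.mono_left nhdsWithin_le_nhds
    simpa using h1.const_mul (C' * (D * M) + J.toReal)
  have hX0 : ‖X‖ ≤ 0 := ge_of_tendsto hlim (by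
    filter_upwards [Ioo_mem_nhdsGT (show (0 : ℝ) < 1 / 2 by norm_num)] with δ hδ using hX δ hδ)
  exact sub_eq_zero.1 (norm_le_zero_iff.1 hX0)

end Inversion

/-! ### Gluing and regularity -/

section Smooth

open Filter
open scoped Topology

variable {d : ℕ} {Ω : Opens (E d)}

/-- The inverse Fourier transform of a rapidly decreasing function is smooth. -/
theorem exists_contDiff_of_decay {F : E d → ℂ} (hFm : AEStronglyMeasurable F)
    (hF : ∀ l : ℕ, ∃ C : ℝ, 0 ≤ C ∧ ∀ ξ : E d, ‖F ξ‖ ≤ C * (1 + ‖ξ‖) ^ (-(l : ℝ))) :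
    ∃ g : E d → ℂ, ContDiff ℝ (⊤ : ℕ∞) g ∧
      ∀ ρ : 𝓢(E d, ℂ), ∫ x, g x * ρ x = ∫ ξ, F ξ * 𝓕⁻ ρ ξ := by
  set G : E d → ℂ := fun ξ => F (-ξ)
  have hGm : AEStronglyMeasurable G :=
    hFm.comp_quasiMeasurePreserving (Measure.measurePreserving_neg volume).quasiMeasurePreserving
  have hint : ∀ n : ℕ, Integrable fun ξ : E d => ‖ξ‖ ^ n * ‖G ξ‖ := by
    intro n
    obtain ⟨C, hC0, hC⟩ := hF (n + (d + 1))
    have h1 : Integrable fun ξ : E d => C * (1 + ‖ξ‖) ^ (-((d : ℝ) + 1)) :=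
      (integrable_one_add_norm (by simp)).const_mul C
    refine h1.mono' ((continuous_norm.pow n).aestronglyMeasurable.mul hGm.norm)
      (Eventually.of_forall fun ξ => ?_)
    rw [Real.norm_of_nonneg (by positivity)]
    have h2 := hC (-ξ)
    rw [norm_neg] at h2
    have h3 : (0 : ℝ) < 1 + ‖ξ‖ := by positivity
    calc ‖ξ‖ ^ n * ‖G ξ‖
        ≤ (1 + ‖ξ‖) ^ n * (C * (1 + ‖ξ‖) ^ (-((n + (d + 1) : ℕ) : ℝ))) := by
          gcongr
          linarith
      _ = C * ((1 + ‖ξ‖) ^ (n : ℝ) * (1 + ‖ξ‖) ^ (-((n + (d + 1) : ℕ) : ℝ))) := by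
          rw [Real.rpow_natCast]; ring
      _ = C * (1 + ‖ξ‖) ^ (-((d : ℝ) + 1)) := by
          rw [← Real.rpow_add h3]
          congr 2
          push_cast
          ring
  have hG : Integrable G := by
    refine (integrable_norm_iff hGm).1 ?_
    simpa using hint 0
  refine ⟨𝓕 G, Real.contDiff_fourier fun n _ => hint n, fun ρ => ?_⟩
  have h1 := VectorFourier.integral_fourierIntegral_smul_eq_flip (L := innerₗ (E d)) (μ := volume)
    (ν := volume) (f := G) (g := ρ) Real.continuous_fourierChar continuous_inner hG ρ.integrable
  rw [flip_innerₗ] at h1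
  calc ∫ x, 𝓕 G x * ρ x = ∫ ξ, G ξ * 𝓕 (ρ : E d → ℂ) ξ := h1
    _ = ∫ ξ, G (-ξ) * 𝓕 (ρ : E d → ℂ) (-ξ) :=
        (integral_neg_eq_self (fun ξ => G ξ * 𝓕 (ρ : E d → ℂ) ξ) volume).symm
    _ = _ := by
        refine integral_congr_ae (Eventually.of_forall fun ξ => ?_)
        simp only [G, neg_neg]
        rw [← Real.fourierInv_eq_fourier_neg, SchwartzMap.fourierInv_coe]

/-- Each localization of a distribution strongly associated to a regular generalized function is
a smooth function. -/
theorem exists_contDiff_localization {p q : ℝ≥0∞} [Fact (1 ≤ p)] [Fact (1 ≤ q)] {T : 𝓓'(Ω, ℂ)}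
    {f : GenFun p q Ω} (hTf : StronglyAssociated T f) (hf : f ∈ GenFun.regular) (χ : 𝓓(Ω, ℂ)) :
    ∃ g : E d → ℂ, ContDiff ℝ (⊤ : ℕ∞) g ∧
      ∀ ρ : 𝓢(E d, ℂ), pair T (mulTest χ ρ) = ∫ x, g x * ρ x := by
  obtain ⟨u, hu, hass⟩ := hTf
  obtain ⟨ω, hχω, hω⟩ := exists_compactlyIn χ.hasCompactSupport.isCompact χ.tsupport_subset
  obtain ⟨b, hb, hbq⟩ := hass ω hω
  obtain ⟨N, hN⟩ := exists_uniformlyAssociated hu.smoothNet hbq χ.hasCompactSupport.isCompact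
    hχω χ.tsupport_subset
  obtain ⟨s, hs⟩ := hf ω hω
  have hdecay := exists_localFourier_decay hu hb hN hω.le hχω hs
  obtain ⟨g, hg, hgρ⟩ := exists_contDiff_of_decay
    (aestronglyMeasurable_localFourier hu.smoothNet hb hN) hdecay
  obtain ⟨A, -, hA⟩ := hdecay 0
  refine ⟨g, hg, fun ρ => ?_⟩
  rw [hgρ, pair_mulTest_eq_integral hu.smoothNet hb hN (A := A) (by simpa using hA)]

/-- A smooth cutoff function that equals `1` near a compact set. -/
theorem exists_cutoff {K : Set (E d)} (hK : IsCompact K) (hKΩ : K ⊆ Ω) :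
    ∃ χ : 𝓓(Ω, ℂ), ∃ U : Set (E d), IsOpen U ∧ K ⊆ U ∧ ∀ x ∈ U, χ x = 1 := by
  obtain ⟨ω, hKω, hω⟩ := exists_compactlyIn hK hKΩ
  obtain ⟨φ, h1, h0, -⟩ := exists_contMDiffMap_one_nhds_of_subset_interior
    (n := (⊤ : ℕ∞)) (modelWithCornersSelf ℝ (E d)) hK.isClosed (t := (ω : Set (E d)))
    (by rwa [ω.isOpen.interior_eq])
  have hsupp : tsupport (fun x => (φ x : ℂ)) ⊆ closure (ω : Set (E d)) := by
    refine closure_mono fun x hx => ?_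
    by_contra hxω
    exact hx (by simp [h0 x hxω])
  obtain ⟨U, hU, hKU, hU1⟩ := eventually_nhdsSet_iff_exists.1 h1
  refine ⟨⟨fun x => (φ x : ℂ), Complex.ofRealCLM.contDiff.comp φ.contMDiff.contDiff,
    hω.1.of_isClosed_subset (isClosed_tsupport _) hsupp, hsupp.trans hω.2⟩, U, hU, hKU,
    fun x hx => ?_⟩
  change (φ x : ℂ) = 1
  rw [hU1 x hx, Complex.ofReal_one]

/-- Two cutoffs that equal `1` on an open set produce the same function there. -/
theorem eqOn_of_localizations {T : 𝓓'(Ω, ℂ)} {χ χ' : 𝓓(Ω, ℂ)} {g g' : E d → ℂ}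
    (hg : Continuous g) (hg' : Continuous g')
    (h : ∀ ρ : 𝓢(E d, ℂ), pair T (mulTest χ ρ) = ∫ x, g x * ρ x)
    (h' : ∀ ρ : 𝓢(E d, ℂ), pair T (mulTest χ' ρ) = ∫ x, g' x * ρ x) {U : Set (E d)}
    (hU : IsOpen U) (hχ : ∀ x ∈ U, χ x = χ' x) : EqOn g g' U := by
  have hae : ∀ᵐ x, x ∈ U → g x - g' x = 0 := by
    refine hU.ae_eq_zero_of_integral_contDiff_smul_eq_zero
      ((hg.sub hg').locallyIntegrable.locallyIntegrableOn U) fun ρ hρ hc hs => ?_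
    set σ : 𝓢(E d, ℂ) := HasCompactSupport.toSchwartzMap (f := fun x => (ρ x : ℂ))
      (hc.comp_left Complex.ofReal_zero) (Complex.ofRealCLM.contDiff.comp hρ)
    have hσ : ∀ x, σ x = (ρ x : ℂ) := fun x => rfl
    have hσc : HasCompactSupport σ := hc.comp_left Complex.ofReal_zero
    have heq : mulTest χ σ = mulTest χ' σ := by
      ext x
      simp only [mulTest_apply, hσ]
      by_cases hx : x ∈ U
      · rw [hχ x hx]
      · rw [image_eq_zero_of_notMem_tsupport fun hx' => hx (hs hx')]
        simp
    have hi : Integrable fun x => g x * σ x :=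
      (hg.mul σ.continuous).integrable_of_hasCompactSupport hσc.mul_left
    have hi' : Integrable fun x => g' x * σ x :=
      (hg'.mul σ.continuous).integrable_of_hasCompactSupport hσc.mul_left
    calc ∫ x, ρ x • (g x - g' x) = ∫ x, (g x * σ x - g' x * σ x) :=
          integral_congr_ae (Eventually.of_forall fun x => by
            simp only [hσ, Complex.real_smul]; ring)
      _ = 0 := by rw [integral_sub hi hi', ← h, ← h', heq, sub_self]
  refine Measure.eqOn_open_of_ae_eq (μ := volume) ?_ hU hg.continuousOn hg'.continuousOn
  rw [EventuallyEq, ae_restrict_iff' hU.measurableSet]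
  filter_upwards [hae] with x hx hxU using sub_eq_zero.1 (hx hxU)

/-- Smoothness is local: the value at `x` of the density of `T` is that of the density of `χ T`, for
any cutoff function `χ` that equals `1` near `x`. -/
theorem isSmooth_of_localizations {T : 𝓓'(Ω, ℂ)}
    (h : ∀ χ : 𝓓(Ω, ℂ), ∃ g : E d → ℂ, ContDiff ℝ (⊤ : ℕ∞) g ∧
      ∀ ρ : 𝓢(E d, ℂ), pair T (mulTest χ ρ) = ∫ x, g x * ρ x) : IsSmooth T := by
  choose G hG hGρ using h
  have hcut : ∀ x : Ω, ∃ χ : 𝓓(Ω, ℂ), ∃ U : Set (E d), IsOpen U ∧ (x : E d) ∈ U ∧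
      ∀ y ∈ U, χ y = 1 := fun x => by
    obtain ⟨χ, U, hU, hxU, h1⟩ := exists_cutoff (Ω := Ω) (isCompact_singleton (x := (x : E d)))
      (singleton_subset_iff.2 x.2)
    exact ⟨χ, U, hU, hxU rfl, h1⟩
  choose χ U hU hxU hχ using hcut
  classical
  let g : E d → ℂ := fun x => if hx : x ∈ Ω then G (χ ⟨x, hx⟩) x else 0
  have hgeq : ∀ (θ : 𝓓(Ω, ℂ)) (V : Set (E d)), IsOpen V → (∀ y ∈ V, θ y = 1) →
      ∀ x ∈ V, x ∈ Ω → g x = G θ x := by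
    intro θ V hV hθ x hxV hx
    have : g x = G (χ ⟨x, hx⟩) x := dif_pos hx
    rw [this]
    exact eqOn_of_localizations (hG _).continuous (hG _).continuous (hGρ _) (hGρ _)
      ((hU ⟨x, hx⟩).inter hV) (fun y hy => (hχ _ y hy.1).trans (hθ y hy.2).symm) ⟨hxU ⟨x, hx⟩, hxV⟩
  refine ⟨g, fun x hx => ContDiffAt.contDiffWithinAt ?_, fun ρ => ?_⟩
  · refine (hG (χ ⟨x, hx⟩)).contDiffAt.congr_of_eventuallyEq ?_
    filter_upwards [(hU ⟨x, hx⟩).mem_nhds (hxU ⟨x, hx⟩), Ω.isOpen.mem_nhds hx] with y hy hyΩ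
    exact hgeq _ _ (hU ⟨x, hx⟩) (hχ ⟨x, hx⟩) y hy hyΩ
  · obtain ⟨θ, V, hV, hρV, hθ⟩ := exists_cutoff ρ.hasCompactSupport.isCompact ρ.tsupport_subset
    set σ : 𝓢(E d, ℂ) := ρ.hasCompactSupport.toSchwartzMap ρ.contDiff
    have hσ : ∀ x, σ x = ρ x := fun x => rfl
    have heq : ρ = mulTest θ σ := by
      ext x
      rw [mulTest_apply, hσ]
      by_cases hx : x ∈ tsupport ρ
      · rw [hθ x (hρV hx), one_mul]
      · rw [image_eq_zero_of_notMem_tsupport hx, mul_zero]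
    calc pair T ρ = ∫ x, G θ x * σ x := by rw [← hGρ, ← heq]
      _ = ∫ x, g x * ρ x := by
        refine integral_congr_ae (Eventually.of_forall fun x => ?_)
        simp only [hσ]
        by_cases hx : x ∈ tsupport ρ
        · rw [hgeq θ V hV hθ x (hρV hx) (ρ.tsupport_subset hx)]
        · rw [image_eq_zero_of_notMem_tsupport hx, mul_zero, mul_zero]

end Smooth

end QGen

theorem mainTheorem3 {d : ℕ} (p q : ℝ≥0∞) [Fact (1 ≤ p)] [Fact (1 ≤ q)]
    (Ω : Opens (QGen.E d)) (T : 𝓓'(Ω, ℂ)) (f : QGen.GenFun p q Ω)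
    (hTf : QGen.StronglyAssociated T f) :
    (f ∈ QGen.GenFun.regular → QGen.IsSmooth T) ∧
    ∀ k : ℕ, (∀ s : ℝ, 0 < s → f ∈ QGen.GenFun.besovType ∞ k s) →
      ∀ s : ℝ, 0 < s → T ∈ QGen.locSpace (QGen.zygmund d ((k : ℝ) - s)) Ω :=
  ⟨fun hf => QGen.isSmooth_of_localizations (QGen.exists_contDiff_localization hTf hf),
    fun k hf _ hs => QGen.mem_locSpace_zygmund T f hTf k hf hs⟩
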